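/- **Setting.** Let $\mathcal M=(\mathcal S,\mathcal A,P,r,\gamma,\rho)$ be a discounted episodic Markov decision process with finite horizon $H\ge 1$, transition model $P(\cdot\mid s,a)$, rewards $r:\mathcal S\times\mathcal A\to[-R,R]$ ($R>0$), discount factor $\gamma\in(0,1)$ and initial distribution $\rho$. Let $\pi_\theta(a\mid s)>0$, $\theta\in\mathbb R^d$, be a differentiable family of policies (densities on $\mathcal A$ with respect to a fixed $\sigma$-finite reference measure). A trajectory $\tau=(s_h,a_h)_{h=0}^{H-1}$ has law $p(\cdot\mid\theta)$ if $s_0\sim\rho$, $a_h\sim\pi_\theta(\cdot\mid s_h)$ and $s_{h+1}\sim P(\cdot\mid s_h,a_h)$. Put $V(\theta)=\mathbb E_{\tau\sim p(\cdot\mid\theta)}\big[\sum_{h=0}^{H-1}\gamma^h r(s_h,a_h)\big]$ and $V^*=\sup_\theta V(\theta)$. With $Z_{\theta,h}(\tau)=\sum_{z=0}^h\nabla_\theta\log\pi_\theta(a_z\mid s_z)$ and $\omega_{0:h}(\tau\mid\theta_2,\theta_1)=\prod_{j=0}^h\frac{\pi_{\theta_1}(a_j\mid s_j)}{\pi_{\theta_2}(a_j\mid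 s_j)}$, the on-policy and off-policy GPOMDP estimators are $$g(\tau\mid\theta)=\sum_{h=0}^{H-1}\gamma^h r(s_h,a_h)Z_{\theta,h}(\tau),\qquad g^{\omega_{\theta_2}}(\tau\mid\theta_1)=\sum_{h=0}^{H-1}\omega_{0:h}(\tau\mid\theta_2,\theta_1)\,\gamma^h r(s_h,a_h)Z_{\theta_1,h}(\tau).$$ **Algorithm (PAGE-PG).** Given $\theta_0\in\mathbb R^d$, batch sizes $N,B\ge1$, a step size $\eta>0$ and $p\in(0,1]$, set $v_0=\frac1N\sum_{i=1}^N g(\tau_i\mid\theta_0)$ with $\tau_i$ i.i.d. from $p(\cdot\mid\theta_0)$. For $t\ge0$ let $\theta_{t+1}=\theta_t+\eta v_t$ and, with fresh i.i.d. trajectories $\tau_i\sim p(\cdot\mid\theta_{t+1})$, $$v_{t+1}=\begin{cases}\frac1N\sum_{i=1}^N g(\tau_i\mid\theta_{t+1})&\text{with probability }p,\\[2pt] \frac1B\sum_{i=1}^B g(\tau_i\mid\theta_{t+1})+v_t-\frac1B\sum_{i=1}^B g^{\omega_{\theta_{t+1}}}(\tau_i\mid\theta_t)&\text{with probability }1-p.\end{cases}$$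 **Theorem.** Suppose that there are constants $G,M,\sigma,W>0$ such that, for all $\theta,\theta_a,\theta_b\in\mathbb R^d$, $s\in\mathcal S$, $a\in\mathcal A$: 1. $\|\nabla_\theta\log\pi_\theta(a\mid s)\|\le G$; 2. $\theta\mapsto\pi_\theta(a\mid s)$ is twice differentiable and $\|\nabla^2_\theta\log\pi_\theta(a\mid s)\|\le M$; 3. $\operatorname{Var}_{\tau\sim p(\cdot\mid\theta)}(g(\tau\mid\theta))=\mathbb E\|g(\tau\mid\theta)-\mathbb E\,g(\tau\mid\theta)\|^2\le\sigma^2$; 4. $\operatorname{Var}_{\tau\sim p(\cdot\mid\theta_b)}\Big(\prod_{j=0}^{H-1}\frac{\pi_{\theta_a}(a_j\mid s_j)}{\pi_{\theta_b}(a_j\mid s_j)}\Big)\le W$. Let $$L=\frac{MR}{(1-\gamma)^2}+\frac{2G^2R}{(1-\gamma)^3},\qquad C_\omega=\frac{24RG^2(2G^2+M)(W+1)\gamma}{(1-\gamma)^5},\qquad C=2(L^2+C_\omega),$$ and assume $\eta^2\le\min\big\{\frac{p}{1-p}\cdot\frac{B}{2C},\ \frac1{4L^2}\big\}$ (for $p=1$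 only $\eta^2\le\frac1{4L^2}$ is required). Then $V$ is differentiable and bounded above, $\|\nabla V(\theta_t)\|^2$ is integrable for every $t$, and for every $T\ge1$ $$\frac1T\sum_{t=0}^{T-1}\mathbb E\big[\|\nabla V(\theta_t)\|^2\big]\le\frac{2\,(V^*-V(\theta_0))}{\eta T}+\frac{\sigma^2}{N}+\frac{\sigma^2}{pNT}.$$ -/

import Mathlib

open MeasureTheory ProbabilityTheory

noncomputable section

/-- The parameter space `ℝ^d` with its Euclidean norm. -/
abbrev Param (d : ℕ) : Type := EuclideanSpace ℝ (Fin d)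

/-- A discounted episodic Markov decision process with horizon `H`, on measurable state and action
spaces. Rewards take values in `[-R, R]`. -/
structure EpisodicMDP (S A : Type*) [MeasurableSpace S] [MeasurableSpace A] where
  /-- The transition model `P(ds' | s, a)`. -/
  P : Kernel (S × A) S
  markov : IsMarkovKernel P
  /-- The initial state distribution. -/
  ρ : Measure S
  prob : IsProbabilityMeasure ρ
  /-- The reward function. -/
  r : S → A → ℝ
  measurable_r : Measurable fun x : S × A => r x.1 x.2
  /-- The reward bound. -/
  R : ℝ
  R_pos : 0 < R
  abs_r_le : ∀ s a, |r s a| ≤ R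
  /-- The discount factor. -/
  γ : ℝ
  γ_pos : 0 < γ
  γ_lt_one : γ < 1
  /-- The horizon. -/
  H : ℕ
  H_pos : 0 < H

/-- A differentiable parametric class of stochastic policies: `π θ s` is an everywhere positive
probability density on the action space with respect to the reference measure `ν` (for example the
counting measure on a finite action space, or Lebesgue measure). Positivity makes `log π` and all
importance weights well-defined. -/
structure PolicyClass (S A : Type*) [MeasurableSpace S] [MeasurableSpace A] (d : ℕ)
    (ν : Measure A) where
  /-- The density `π_θ(a | s)`. -/
  π : Param d → S → A → ℝ
  π_pos : ∀ θ s a, 0 < π θ s a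
  measurable_π : Measurable fun x : Param d × S × A => π x.1 x.2.1 x.2.2
  lintegral_π : ∀ θ s, ∫⁻ a, ENNReal.ofReal (π θ s a) ∂ν = 1
  differentiable_π : ∀ s a, Differentiable ℝ fun θ => π θ s a

/-- A trajectory `(s_0, a_0), …, (s_{H-1}, a_{H-1})`. -/
abbrev Traj (S A : Type*) (H : ℕ) : Type _ := Fin H → S × A

section Measurability

variable {X Y Z : Type*} [MeasurableSpace X] [MeasurableSpace Y] [MeasurableSpace Z]

theorem measurable_bind_param (κ : X → Measure Y) (hκ : Measurable κ)
    (hp : ∀ x, IsProbabilityMeasure (κ x)) (f : X → Y → Measure Z)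
    (hf : Measurable fun q : X × Y => f q.1 q.2) : Measurable fun x => (κ x).bind (f x) := by
  refine Measure.measurable_of_measurable_coe _ fun s hs => ?_
  let K : Kernel X Y := ⟨κ, hκ⟩
  have : IsMarkovKernel K := ⟨hp⟩
  have h1 : ∀ x, (κ x).bind (f x) s = ∫⁻ y, f x y s ∂(K x) := fun x =>
    Measure.bind_apply hs (hf.comp measurable_prodMk_left).aemeasurable
  simp only [h1]
  exact Measurable.lintegral_kernel_prod_right ((Measure.measurable_coe hs).comp hf)

theorem measurable_map_param (κ : X → Measure Y) (hκ : Measurable κ)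
    (hp : ∀ x, IsProbabilityMeasure (κ x)) (f : X → Y → Z)
    (hf : Measurable fun q : X × Y => f q.1 q.2) : Measurable fun x => (κ x).map (f x) := by
  refine Measure.measurable_of_measurable_coe _ fun s hs => ?_
  let K : Kernel X Y := ⟨κ, hκ⟩
  have : IsMarkovKernel K := ⟨hp⟩
  have h1 : ∀ x, (κ x).map (f x) s = K x (Prod.mk x ⁻¹' ((fun q : X × Y => f q.1 q.2) ⁻¹' s)) :=
    fun x => by
      rw [Measure.map_apply (f := f x) (hf.comp measurable_prodMk_left) hs]
      rfl
  simp only [h1]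
  exact Kernel.measurable_kernel_prodMk_left (hf hs)

theorem measurable_pi_param (n : ℕ) (κ : X → Measure Y) (hκ : Measurable κ)
    (hp : ∀ x, IsProbabilityMeasure (κ x)) :
    Measurable fun x => Measure.pi fun _ : Fin n => κ x := by
  refine Measurable.measure_of_isPiSystem_of_isProbabilityMeasure generateFrom_pi.symm isPiSystem_pi
    ?_
  rintro _ ⟨t, ht, rfl⟩
  simp only [Measure.pi_pi]
  exact Finset.measurable_fun_prod _ fun i _ =>
    (Measure.measurable_coe (ht i (Set.mem_univ i))).comp hκ

end Measurability

namespace PolicyClass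

variable {S A : Type*} [MeasurableSpace S] [MeasurableSpace A] {d : ℕ} {ν : Measure A}

/-- The law `π_θ(· | s)` of the action played in state `s`. -/
def actionLaw (Pol : PolicyClass S A d ν) (θ : Param d) (s : S) : Measure A :=
  ν.withDensity fun a => ENNReal.ofReal (Pol.π θ s a)

/-- The score `∇_θ log π_θ(a | s)`. -/
def score (Pol : PolicyClass S A d ν) (θ : Param d) (s : S) (a : A) : Param d :=
  gradient (fun θ' => Real.log (Pol.π θ' s a)) θ

/-- `Z_{θ,h} = ∑_{z=0}^h ∇_θ log π_θ(a_z | s_z)`. -/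
def scoreSum (Pol : PolicyClass S A d ν) {H : ℕ} (θ : Param d) (τ : Traj S A H) (h : Fin H) :
    Param d :=
  ∑ z ∈ Finset.univ.filter (fun z : Fin H => z ≤ h), Pol.score θ (τ z).1 (τ z).2

/-- The truncated importance weight `ω_{0:h}(τ | θ₂, θ₁)`, where `θ₂` is the sampling policy. -/
def weightUpTo (Pol : PolicyClass S A d ν) {H : ℕ} (θ₂ θ₁ : Param d) (τ : Traj S A H) (h : Fin H) :
    ℝ :=
  ∏ j ∈ Finset.univ.filter (fun j : Fin H => j ≤ h),
    Pol.π θ₁ (τ j).1 (τ j).2 / Pol.π θ₂ (τ j).1 (τ j).2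

/-- The importance weight `ω(τ | θ₂, θ₁) = p(τ | θ₁) / p(τ | θ₂)` of a full trajectory. -/
def weight (Pol : PolicyClass S A d ν) {H : ℕ} (θ₂ θ₁ : Param d) (τ : Traj S A H) : ℝ :=
  ∏ j : Fin H, Pol.π θ₁ (τ j).1 (τ j).2 / Pol.π θ₂ (τ j).1 (τ j).2

theorem isProbabilityMeasure_actionLaw (Pol : PolicyClass S A d ν) (θ : Param d) (s : S) :
    IsProbabilityMeasure (Pol.actionLaw θ s) :=
  ⟨by simp [actionLaw, Pol.lintegral_π]⟩

theorem measurable_actionLaw [SigmaFinite ν] (Pol : PolicyClass S A d ν) :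
    Measurable fun x : Param d × S => Pol.actionLaw x.1 x.2 := by
  refine Measure.measurable_of_measurable_coe _ fun s hs => ?_
  simp only [actionLaw, withDensity_apply _ hs]
  have : Measurable fun q : (Param d × S) × A => ENNReal.ofReal (Pol.π q.1.1 q.1.2 q.2) :=
    (Pol.measurable_π.comp ((measurable_fst.comp measurable_fst).prodMk
      ((measurable_snd.comp measurable_fst).prodMk measurable_snd))).ennreal_ofReal
  exact this.lintegral_prod_right'

theorem measurable_score (Pol : PolicyClass S A d ν) :
    Measurable fun x : Param d × S × A => Pol.score x.1 x.2.1 x.2.2 := by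
  have hd : ∀ s a θ, DifferentiableAt ℝ (fun θ' => Real.log (Pol.π θ' s a)) θ := fun s a θ =>
    ((Pol.differentiable_π s a) θ).log (Pol.π_pos θ s a).ne'
  have key : ∀ e : Param d,
      Measurable fun x : Param d × S × A => inner ℝ (Pol.score x.1 x.2.1 x.2.2) e := by
    intro e
    have hlim : ∀ x : Param d × S × A, Filter.Tendsto (fun n : ℕ => ((n : ℝ) + 1) *
        (Real.log (Pol.π (x.1 + ((n : ℝ) + 1)⁻¹ • e) x.2.1 x.2.2) -
          Real.log (Pol.π x.1 x.2.1 x.2.2))) Filter.atTop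
        (nhds (inner ℝ (Pol.score x.1 x.2.1 x.2.2) e)) := by
      intro x
      have h1 := (hd x.2.1 x.2.2 x.1).hasGradientAt.hasFDerivAt
      have h2 := h1.lim e (c := fun n : ℕ => (n : ℝ) + 1) (l := Filter.atTop) ?_ |>.congr
        (f₂ := fun n : ℕ => ((n : ℝ) + 1) *
        (Real.log (Pol.π (x.1 + ((n : ℝ) + 1)⁻¹ • e) x.2.1 x.2.2) -
          Real.log (Pol.π x.1 x.2.1 x.2.2))) ?_
      · simpa [score] using h2
      · exact Filter.tendsto_atTop_mono (fun n => by
          rw [Real.norm_eq_abs]; exact (le_add_of_nonneg_right zero_le_one).trans (le_abs_self _))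
          tendsto_natCast_atTop_atTop
      · intro n
        simp
    refine measurable_of_tendsto_metrizable (fun n => ?_) (tendsto_pi_nhds.2 hlim)
    refine measurable_const.mul (Measurable.sub (Measurable.log ?_) (Measurable.log ?_))
    · exact Pol.measurable_π.comp ((measurable_fst.add_const _).prodMk measurable_snd)
    · exact Pol.measurable_π
  have hsum : (fun x : Param d × S × A => Pol.score x.1 x.2.1 x.2.2) = fun x =>
      ∑ i, (inner ℝ (Pol.score x.1 x.2.1 x.2.2) (EuclideanSpace.basisFun (Fin d) ℝ i)) •
        EuclideanSpace.basisFun (Fin d) ℝ i := by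
    funext x
    conv_lhs => rw [← (EuclideanSpace.basisFun (Fin d) ℝ).sum_repr' (Pol.score x.1 x.2.1 x.2.2)]
    exact Finset.sum_congr rfl fun i _ => by rw [real_inner_comm]
  rw [hsum]
  exact Finset.measurable_fun_sum _ fun i _ => (key _).smul_const _

end PolicyClass

namespace EpisodicMDP

variable {S A : Type*} [MeasurableSpace S] [MeasurableSpace A] {d : ℕ} {ν : Measure A}

/-- Law of the first `n` state-action pairs when the initial state is `s`: the action is
`a ∼ π_θ(· | s)`, the next state is `s' ∼ P(· | s, a)`, and one continues from `s'`. -/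
def rollout (𝓜 : EpisodicMDP S A) (Pol : PolicyClass S A d ν) (θ : Param d) :
    (n : ℕ) → S → Measure (Traj S A n)
  | 0, _ => Measure.dirac Fin.elim0
  | n + 1, s => (Pol.actionLaw θ s).bind fun a => (𝓜.P (s, a)).bind fun s' =>
      (𝓜.rollout Pol θ n s').map fun τ => Fin.cons (s, a) τ

/-- The trajectory distribution `p(· | θ)`, with `s_0 ∼ ρ`. -/
def trajLaw (𝓜 : EpisodicMDP S A) (Pol : PolicyClass S A d ν) (θ : Param d) :
    Measure (Traj S A 𝓜.H) :=
  𝓜.ρ.bind fun s => 𝓜.rollout Pol θ 𝓜.H s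

/-- The discounted cumulative reward `R(τ)`. -/
def ret (𝓜 : EpisodicMDP S A) (τ : Traj S A 𝓜.H) : ℝ :=
  ∑ h : Fin 𝓜.H, 𝓜.γ ^ (h : ℕ) * 𝓜.r (τ h).1 (τ h).2

/-- The value function `V^{π_θ}(s)`. -/
def valueFrom (𝓜 : EpisodicMDP S A) (Pol : PolicyClass S A d ν) (θ : Param d) (s : S) : ℝ :=
  ∫ τ, 𝓜.ret τ ∂(𝓜.rollout Pol θ 𝓜.H s)

/-- The objective `V(θ) = V^{π_θ}(ρ)`. -/
def value (𝓜 : EpisodicMDP S A) (Pol : PolicyClass S A d ν) (θ : Param d) : ℝ :=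
  ∫ s, 𝓜.valueFrom Pol θ s ∂𝓜.ρ

/-- The optimal value `V^* = sup_θ V(θ)`. -/
def optValue (𝓜 : EpisodicMDP S A) (Pol : PolicyClass S A d ν) : ℝ :=
  ⨆ θ, 𝓜.value Pol θ

/-- The GPOMDP estimator `g(τ | θ)`. -/
def gpomdp (𝓜 : EpisodicMDP S A) (Pol : PolicyClass S A d ν) (θ : Param d) (τ : Traj S A 𝓜.H) :
    Param d :=
  ∑ h : Fin 𝓜.H, (𝓜.γ ^ (h : ℕ) * 𝓜.r (τ h).1 (τ h).2) • Pol.scoreSum θ τ h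

/-- The off-policy GPOMDP estimator `g^{ω_{θ₂}}(τ | θ₁)`, for trajectories sampled with `θ₂`. -/
def gpomdpOff (𝓜 : EpisodicMDP S A) (Pol : PolicyClass S A d ν) (θ₂ θ₁ : Param d)
    (τ : Traj S A 𝓜.H) : Param d :=
  ∑ h : Fin 𝓜.H,
    (Pol.weightUpTo θ₂ θ₁ τ h * (𝓜.γ ^ (h : ℕ) * 𝓜.r (τ h).1 (τ h).2)) • Pol.scoreSum θ₁ τ h

/-- The law of `n` independent trajectories sampled with policy `θ`. -/
def batchLaw (𝓜 : EpisodicMDP S A) (Pol : PolicyClass S A d ν) (n : ℕ) (θ : Param d) :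
    Measure (Fin n → Traj S A 𝓜.H) :=
  Measure.pi fun _ => 𝓜.trajLaw Pol θ

/-- The large-batch gradient estimate `(1/n) ∑ g(τ_i | θ)`. -/
def largeEstimate (𝓜 : EpisodicMDP S A) (Pol : PolicyClass S A d ν) {n : ℕ} (θ : Param d)
    (τ : Fin n → Traj S A 𝓜.H) : Param d :=
  (n : ℝ)⁻¹ • ∑ i, 𝓜.gpomdp Pol θ (τ i)

/-- The recursive small-batch estimate
`(1/n) ∑ g(τ_i | θ') + v - (1/n) ∑ g^{ω_{θ'}}(τ_i | θ)`, where `θ'` is the current parameter, `θ` the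
previous one and `v` the previous estimate. -/
def smallEstimate (𝓜 : EpisodicMDP S A) (Pol : PolicyClass S A d ν) {n : ℕ} (θ' θ v : Param d)
    (τ : Fin n → Traj S A 𝓜.H) : Param d :=
  (n : ℝ)⁻¹ • ∑ i, 𝓜.gpomdp Pol θ' (τ i) + v - (n : ℝ)⁻¹ • ∑ i, 𝓜.gpomdpOff Pol θ' θ (τ i)

/-- One iteration of PAGE-PG: the conditional law of `(θ_{t+1}, v_{t+1})` given
`x = (θ_t, v_t)`. The parameter becomes `θ_{t+1} = θ_t + η v_t`; then, with trajectories sampled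
with `θ_{t+1}`, the large-batch estimate is used with probability `p` and the recursive small-batch
estimate with probability `1 - p`. -/
def pageStep (𝓜 : EpisodicMDP S A) (Pol : PolicyClass S A d ν) (N B : ℕ) (η p : ℝ)
    (x : Param d × Param d) : Measure (Param d × Param d) :=
  ENNReal.ofReal p • (𝓜.batchLaw Pol N (x.1 + η • x.2)).map
      (fun τ => (x.1 + η • x.2, 𝓜.largeEstimate Pol (x.1 + η • x.2) τ)) +
    ENNReal.ofReal (1 - p) • (𝓜.batchLaw Pol B (x.1 + η • x.2)).map
      (fun τ => (x.1 + η • x.2, 𝓜.smallEstimate Pol (x.1 + η • x.2) x.1 x.2 τ))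

/-- The joint law of the PAGE-PG parameter and gradient estimate `(θ_t, v_t)`, started at `θ₀` with
the large-batch estimate `v_0`. -/
def pageLaw (𝓜 : EpisodicMDP S A) (Pol : PolicyClass S A d ν) (θ₀ : Param d) (N B : ℕ) (η p : ℝ) :
    ℕ → Measure (Param d × Param d)
  | 0 => (𝓜.batchLaw Pol N θ₀).map fun τ => (θ₀, 𝓜.largeEstimate Pol θ₀ τ)
  | t + 1 => (𝓜.pageLaw Pol θ₀ N B η p t).bind (𝓜.pageStep Pol N B η p)

/-- The smoothness constant `L = M R / (1-γ)^2 + 2 G^2 R / (1-γ)^3`. -/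
def constL (𝓜 : EpisodicMDP S A) (G M : ℝ) : ℝ :=
  M * 𝓜.R / (1 - 𝓜.γ) ^ 2 + 2 * G ^ 2 * 𝓜.R / (1 - 𝓜.γ) ^ 3

/-- The constant `C_ω = 24 R G^2 (2 G^2 + M) (W + 1) γ / (1-γ)^5`. -/
def constCω (𝓜 : EpisodicMDP S A) (G M W : ℝ) : ℝ :=
  24 * 𝓜.R * G ^ 2 * (2 * G ^ 2 + M) * (W + 1) * 𝓜.γ / (1 - 𝓜.γ) ^ 5

/-- The constant `C = 2 (L^2 + C_ω)`. -/
def constC (𝓜 : EpisodicMDP S A) (G M W : ℝ) : ℝ :=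
  2 * (𝓜.constL G M ^ 2 + 𝓜.constCω G M W)

/-! The laws above are probability measures and depend measurably on their parameters, so no
junk value enters the definition of `pageLaw`. -/

theorem measurable_rollout_aux [SigmaFinite ν] (𝓜 : EpisodicMDP S A) (Pol : PolicyClass S A d ν)
    (n : ℕ) : (∀ θ s, IsProbabilityMeasure (𝓜.rollout Pol θ n s)) ∧
      Measurable fun x : Param d × S => 𝓜.rollout Pol x.1 n x.2 := by
  have := 𝓜.markov
  induction n with
  | zero => exact ⟨fun θ s => by unfold rollout; infer_instance, measurable_const⟩
  | succ n ih =>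
    obtain ⟨ihp, ihm⟩ := ih
    have hmap : Measurable fun q : ((Param d × S) × A) × S =>
        (𝓜.rollout Pol q.1.1.1 n q.2).map fun τ =>
          (Fin.cons (q.1.1.2, q.1.2) τ : Traj S A (n + 1)) := by
      refine measurable_map_param (fun q : ((Param d × S) × A) × S => 𝓜.rollout Pol q.1.1.1 n q.2)
        (ihm.comp (by fun_prop : Measurable fun q : ((Param d × S) × A) × S => (q.1.1.1, q.2)))
        (fun q => ihp _ _) (fun q τ => (Fin.cons (q.1.1.2, q.1.2) τ : Traj S A (n + 1))) ?_
      refine measurable_pi_lambda _ fun i => ?_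
      refine Fin.cases ?_ (fun j => ?_) i
      · simp only [Fin.cons_zero]; fun_prop
      · simp only [Fin.cons_succ]; fun_prop
    have hin : Measurable fun q : (Param d × S) × A => (𝓜.P (q.1.2, q.2)).bind fun s' =>
        (𝓜.rollout Pol q.1.1 n s').map fun τ =>
          (Fin.cons (q.1.2, q.2) τ : Traj S A (n + 1)) :=
      measurable_bind_param (fun q : (Param d × S) × A => 𝓜.P (q.1.2, q.2))
        (𝓜.P.measurable.comp (by fun_prop)) (fun q => inferInstance) _ hmap
    refine ⟨fun θ s => ?_, ?_⟩
    · have := Pol.isProbabilityMeasure_actionLaw θ s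
      unfold rollout
      refine isProbabilityMeasure_bind
        (hin.comp (by fun_prop : Measurable fun a : A => ((θ, s), a))).aemeasurable
        (Filter.Eventually.of_forall fun a => ?_)
      refine isProbabilityMeasure_bind
        (hmap.comp (by fun_prop : Measurable fun s' : S => (((θ, s), a), s'))).aemeasurable
        (Filter.Eventually.of_forall fun s' => ?_)
      have := ihp θ s'
      refine Measure.isProbabilityMeasure_map (Measurable.aemeasurable ?_)
      refine measurable_pi_lambda _ fun i => ?_
      refine Fin.cases ?_ (fun j => ?_) i
      · simp only [Fin.cons_zero]; fun_prop
      · simp only [Fin.cons_succ]; fun_prop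
    · exact measurable_bind_param _ Pol.measurable_actionLaw
        (fun x => Pol.isProbabilityMeasure_actionLaw _ _) _ hin

theorem isProbabilityMeasure_trajLaw [SigmaFinite ν] (𝓜 : EpisodicMDP S A)
    (Pol : PolicyClass S A d ν) (θ : Param d) : IsProbabilityMeasure (𝓜.trajLaw Pol θ) := by
  have := 𝓜.prob
  obtain ⟨hp, hm⟩ := 𝓜.measurable_rollout_aux Pol 𝓜.H
  exact isProbabilityMeasure_bind (hm.comp (by fun_prop : Measurable fun s : S => (θ, s))).aemeasurable
    (Filter.Eventually.of_forall fun s => hp θ s)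

theorem measurable_trajLaw [SigmaFinite ν] (𝓜 : EpisodicMDP S A) (Pol : PolicyClass S A d ν) :
    Measurable (𝓜.trajLaw Pol) := by
  have := 𝓜.prob
  obtain ⟨_, hm⟩ := 𝓜.measurable_rollout_aux Pol 𝓜.H
  exact measurable_bind_param (fun _ : Param d => 𝓜.ρ) measurable_const (fun _ => inferInstance) _ hm

section

variable {Ω : Type*} [MeasurableSpace Ω]

theorem measurable_scoreSum (𝓜 : EpisodicMDP S A) (Pol : PolicyClass S A d ν) {θ : Ω → Param d}
    {τ : Ω → Traj S A 𝓜.H} (hθ : Measurable θ) (hτ : Measurable τ) (h : Fin 𝓜.H) :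
    Measurable fun ω => Pol.scoreSum (θ ω) (τ ω) h := by
  have hz : ∀ z, Measurable fun ω => τ ω z := fun z => (measurable_pi_apply z).comp hτ
  exact Finset.measurable_fun_sum _ fun z _ => Pol.measurable_score.comp (hθ.prodMk (hz z))

theorem measurable_gpomdp (𝓜 : EpisodicMDP S A) (Pol : PolicyClass S A d ν) {θ : Ω → Param d}
    {τ : Ω → Traj S A 𝓜.H} (hθ : Measurable θ) (hτ : Measurable τ) :
    Measurable fun ω => 𝓜.gpomdp Pol (θ ω) (τ ω) := by
  have hr : ∀ h, Measurable fun ω => 𝓜.r (τ ω h).1 (τ ω h).2 := fun h =>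
    𝓜.measurable_r.comp ((measurable_pi_apply h).comp hτ)
  exact Finset.measurable_fun_sum _ fun h _ =>
    ((hr h).const_mul _).smul (𝓜.measurable_scoreSum Pol hθ hτ h)

theorem measurable_gpomdpOff (𝓜 : EpisodicMDP S A) (Pol : PolicyClass S A d ν)
    {θ₂ θ₁ : Ω → Param d} {τ : Ω → Traj S A 𝓜.H} (hθ₂ : Measurable θ₂) (hθ₁ : Measurable θ₁)
    (hτ : Measurable τ) : Measurable fun ω => 𝓜.gpomdpOff Pol (θ₂ ω) (θ₁ ω) (τ ω) := by
  have hz : ∀ z, Measurable fun ω => τ ω z := fun z => (measurable_pi_apply z).comp hτ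
  have hr : ∀ h, Measurable fun ω => 𝓜.r (τ ω h).1 (τ ω h).2 := fun h =>
    𝓜.measurable_r.comp (hz h)
  have hp₁ : ∀ j, Measurable fun ω => Pol.π (θ₁ ω) (τ ω j).1 (τ ω j).2 := fun j =>
    Pol.measurable_π.comp (hθ₁.prodMk (hz j))
  have hp₂ : ∀ j, Measurable fun ω => Pol.π (θ₂ ω) (τ ω j).1 (τ ω j).2 := fun j =>
    Pol.measurable_π.comp (hθ₂.prodMk (hz j))
  have hw : ∀ h, Measurable fun ω => Pol.weightUpTo (θ₂ ω) (θ₁ ω) (τ ω) h := fun h =>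
    Finset.measurable_fun_prod _ fun j _ => (hp₁ j).div (hp₂ j)
  exact Finset.measurable_fun_sum _ fun h _ =>
    ((hw h).mul ((hr h).const_mul _)).smul (𝓜.measurable_scoreSum Pol hθ₁ hτ h)

theorem measurable_largeEstimate (𝓜 : EpisodicMDP S A) (Pol : PolicyClass S A d ν) {n : ℕ}
    {θ : Ω → Param d} {τ : Ω → Fin n → Traj S A 𝓜.H} (hθ : Measurable θ) (hτ : Measurable τ) :
    Measurable fun ω => 𝓜.largeEstimate Pol (θ ω) (τ ω) :=
  (Finset.measurable_fun_sum Finset.univ fun i _ =>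
    𝓜.measurable_gpomdp Pol hθ ((measurable_pi_apply i).comp hτ)).fun_const_smul _

theorem measurable_smallEstimate (𝓜 : EpisodicMDP S A) (Pol : PolicyClass S A d ν) {n : ℕ}
    {θ' θ v : Ω → Param d} {τ : Ω → Fin n → Traj S A 𝓜.H} (hθ' : Measurable θ')
    (hθ : Measurable θ) (hv : Measurable v) (hτ : Measurable τ) :
    Measurable fun ω => 𝓜.smallEstimate Pol (θ' ω) (θ ω) (v ω) (τ ω) :=
  ((𝓜.measurable_largeEstimate Pol hθ' hτ).add hv).sub
    ((Finset.measurable_fun_sum Finset.univ fun i _ =>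
      𝓜.measurable_gpomdpOff Pol hθ' hθ ((measurable_pi_apply i).comp hτ)).fun_const_smul _)

theorem measurable_nextParam (η : ℝ) {x : Ω → Param d × Param d} (hx : Measurable x) :
    Measurable fun ω => (x ω).1 + η • (x ω).2 :=
  hx.fst.add (hx.snd.fun_const_smul η)

theorem measurable_largeStep (𝓜 : EpisodicMDP S A) (Pol : PolicyClass S A d ν) {N : ℕ} (η : ℝ)
    {x : Ω → Param d × Param d} {τ : Ω → Fin N → Traj S A 𝓜.H} (hx : Measurable x)
    (hτ : Measurable τ) : Measurable fun ω => ((x ω).1 + η • (x ω).2,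
      𝓜.largeEstimate Pol ((x ω).1 + η • (x ω).2) (τ ω)) :=
  (measurable_nextParam η hx).prodMk
    (𝓜.measurable_largeEstimate Pol (measurable_nextParam η hx) hτ)

theorem measurable_smallStep (𝓜 : EpisodicMDP S A) (Pol : PolicyClass S A d ν) {B : ℕ} (η : ℝ)
    {x : Ω → Param d × Param d} {τ : Ω → Fin B → Traj S A 𝓜.H} (hx : Measurable x)
    (hτ : Measurable τ) : Measurable fun ω => ((x ω).1 + η • (x ω).2,
      𝓜.smallEstimate Pol ((x ω).1 + η • (x ω).2) (x ω).1 (x ω).2 (τ ω)) :=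
  (measurable_nextParam η hx).prodMk
    (𝓜.measurable_smallEstimate Pol (measurable_nextParam η hx) hx.fst hx.snd hτ)

end

theorem isProbabilityMeasure_batchLaw [SigmaFinite ν] (𝓜 : EpisodicMDP S A)
    (Pol : PolicyClass S A d ν) (n : ℕ) (θ : Param d) :
    IsProbabilityMeasure (𝓜.batchLaw Pol n θ) := by
  have := 𝓜.isProbabilityMeasure_trajLaw Pol θ
  unfold batchLaw
  infer_instance

theorem measurable_batchLaw [SigmaFinite ν] (𝓜 : EpisodicMDP S A) (Pol : PolicyClass S A d ν)
    (n : ℕ) : Measurable (𝓜.batchLaw Pol n) :=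
  measurable_pi_param n _ (𝓜.measurable_trajLaw Pol) (𝓜.isProbabilityMeasure_trajLaw Pol)

theorem measurable_pageStep [SigmaFinite ν] (𝓜 : EpisodicMDP S A) (Pol : PolicyClass S A d ν)
    (N B : ℕ) (η p : ℝ) : Measurable (𝓜.pageStep Pol N B η p) := by
  have h₁ := measurable_map_param (fun x : Param d × Param d => 𝓜.batchLaw Pol N (x.1 + η • x.2))
    ((𝓜.measurable_batchLaw Pol N).comp (measurable_nextParam η measurable_id))
    (fun x => 𝓜.isProbabilityMeasure_batchLaw Pol N _)
    (fun x τ => (x.1 + η • x.2, 𝓜.largeEstimate Pol (x.1 + η • x.2) τ))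
    (𝓜.measurable_largeStep Pol η measurable_fst measurable_snd)
  have h₂ := measurable_map_param (fun x : Param d × Param d => 𝓜.batchLaw Pol B (x.1 + η • x.2))
    ((𝓜.measurable_batchLaw Pol B).comp (measurable_nextParam η measurable_id))
    (fun x => 𝓜.isProbabilityMeasure_batchLaw Pol B _)
    (fun x τ => (x.1 + η • x.2, 𝓜.smallEstimate Pol (x.1 + η • x.2) x.1 x.2 τ))
    (𝓜.measurable_smallStep Pol η measurable_fst measurable_snd)
  refine Measure.measurable_of_measurable_coe _ fun s hs => ?_
  exact (((Measure.measurable_coe hs).comp h₁).const_mul (ENNReal.ofReal p)).add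
    (((Measure.measurable_coe hs).comp h₂).const_mul (ENNReal.ofReal (1 - p)))

theorem isProbabilityMeasure_pageStep [SigmaFinite ν] (𝓜 : EpisodicMDP S A)
    (Pol : PolicyClass S A d ν) (N B : ℕ) (η p : ℝ) (hp0 : 0 ≤ p) (hp1 : p ≤ 1)
    (x : Param d × Param d) : IsProbabilityMeasure (𝓜.pageStep Pol N B η p x) := by
  have hN := 𝓜.isProbabilityMeasure_batchLaw Pol N (x.1 + η • x.2)
  have hB := 𝓜.isProbabilityMeasure_batchLaw Pol B (x.1 + η • x.2)
  have h₁ := Measure.isProbabilityMeasure_map (μ := 𝓜.batchLaw Pol N (x.1 + η • x.2))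
    (𝓜.measurable_largeStep Pol (N := N) η (measurable_const (a := x)) measurable_id).aemeasurable
  have h₂ := Measure.isProbabilityMeasure_map (μ := 𝓜.batchLaw Pol B (x.1 + η • x.2))
    (𝓜.measurable_smallStep Pol (B := B) η (measurable_const (a := x)) measurable_id).aemeasurable
  have e : 𝓜.pageStep Pol N B η p x Set.univ =
      ENNReal.ofReal p * _ + ENNReal.ofReal (1 - p) * _ := rfl
  refine ⟨e.trans ((congrArg₂ (fun a b => ENNReal.ofReal p * a + ENNReal.ofReal (1 - p) * b)
    h₁.measure_univ h₂.measure_univ).trans ?_)⟩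
  simp only [mul_one]
  rw [← ENNReal.ofReal_add hp0 (sub_nonneg.2 hp1)]
  simp

theorem isProbabilityMeasure_pageLaw [SigmaFinite ν] (𝓜 : EpisodicMDP S A)
    (Pol : PolicyClass S A d ν) (θ₀ : Param d) (N B : ℕ) (η p : ℝ) (hp0 : 0 ≤ p) (hp1 : p ≤ 1)
    (t : ℕ) : IsProbabilityMeasure (𝓜.pageLaw Pol θ₀ N B η p t) := by
  induction t with
  | zero =>
    have hN := 𝓜.isProbabilityMeasure_batchLaw Pol N θ₀
    exact Measure.isProbabilityMeasure_map (measurable_const.prodMk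
      (𝓜.measurable_largeEstimate Pol measurable_const measurable_id)).aemeasurable
  | succ t ih =>
    exact isProbabilityMeasure_bind (𝓜.measurable_pageStep Pol N B η p).aemeasurable
      (Filter.Eventually.of_forall (𝓜.isProbabilityMeasure_pageStep Pol N B η p hp0 hp1))

end EpisodicMDP

end

/-! ### Change of measure for one action, recursion for the importance weights -/

namespace PolicyClass

variable {S A : Type*} [MeasurableSpace S] [MeasurableSpace A] {d : ℕ} {ν : Measure A}

/-! The argument is a Lyapunov analysis of the pair (θ, v) with Φ = V* - V(θ) + a‖v - ∇V(θ)‖² and a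
= η/(2p). Since V is L-smooth and ηL ≤ 1/2, a step lowers the gap by (η/2)‖∇V‖² + (η/4)‖v‖², up to
an error (η/2)‖v - ∇V‖². A restart, of probability p, replaces the squared error by at most σ²/N on
average. A recursive update keeps the old error and adds at most D/B, where D is the second moment
of the difference between the on-policy and off-policy estimators. The choice of a makes pa = η/2,
so the old error is paid for by the restarts, and D/B is paid for by (η/4)‖v‖² as soon as D ≤
C‖ηv‖². Telescoping gives the rate.

Both the smoothness of V and the bound on D come from comparing g(τ|θ₂) with the off-policy
estimator at θ₁. Changing measure makes V(θ₁) an integral against the fixed law p(·|θ₂);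
differentiating there shows that the off-policy estimator is unbiased for ∇V(θ₁)
(`hasGradientAt_value`). With y = G‖θ₁ - θ₂‖, a one-step ratio lies in [e^{-y}, e^y] and has mean 1,
hence has second moment at most 2 cosh y - 1; conditioning step by step, a weight of h+1 steps has
second moment at most (2 cosh y - 1)^{h+1}. This grows geometrically, but the discount absorbs it
when y is at most a fixed multiple of 1 - γ, which gives D ≤ 2L²‖θ₁ - θ₂‖²
(`integral_norm_gpomdp_sub_sq_le_two_mul`). For the Lipschitz bound on ∇V short distances suffice,
by subdividing segments.

There is no a priori bound on ‖v‖, so a step may leave this range. The remedy is to truncate Φ at a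
level K (`truncLevel`). If Φ ≤ K, the error of v is bounded, the step is short enough
(`step_le_of_lyapunov_le`) and the analysis above applies. If Φ > K, the recursive branch is bounded
by K itself, while a restart brings the expectation down to 2R/(1-γ) + aσ²/N; K is chosen so that p
times this drop covers (η/2)‖∇V‖² (`exists_smallStep_bound`). Both cases give the same inequality
for min(Φ, K), `lintegral_truncLyapunov_pageStep_le`, which is then summed over the iterations. -/

theorem lintegral_actionLaw (Pol : PolicyClass S A d ν) (θ : Param d) (s : S) (f : A → ENNReal) :
    ∫⁻ a, f a ∂(Pol.actionLaw θ s) = ∫⁻ a, ENNReal.ofReal (Pol.π θ s a) * f a ∂ν := by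
  have hm : Measurable fun a => ENNReal.ofReal (Pol.π θ s a) :=
    (Pol.measurable_π.comp (by fun_prop : Measurable fun a : A => (θ, s, a))).ennreal_ofReal
  unfold actionLaw
  rw [lintegral_withDensity_eq_lintegral_mul_non_measurable _ hm (by simp)]
  simp

/-- Change of measure for a single action. -/
theorem lintegral_actionLaw_ratio (Pol : PolicyClass S A d ν) (θ₂ θ₁ : Param d) (s : S)
    (f : A → ENNReal) :
    ∫⁻ a, ENNReal.ofReal (Pol.π θ₁ s a / Pol.π θ₂ s a) * f a ∂(Pol.actionLaw θ₂ s) =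
      ∫⁻ a, f a ∂(Pol.actionLaw θ₁ s) := by
  rw [lintegral_actionLaw, lintegral_actionLaw]
  refine lintegral_congr fun a => ?_
  rw [← mul_assoc, ← ENNReal.ofReal_mul (Pol.π_pos _ _ _).le,
    mul_div_cancel₀ _ (Pol.π_pos _ _ _).ne']

theorem weightUpTo_cons_zero (Pol : PolicyClass S A d ν) {n : ℕ} (θ₂ θ₁ : Param d) (x : S × A)
    (τ : Traj S A n) :
    Pol.weightUpTo θ₂ θ₁ (Fin.cons x τ : Traj S A (n + 1)) 0 =
      Pol.π θ₁ x.1 x.2 / Pol.π θ₂ x.1 x.2 := by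
  unfold weightUpTo
  rw [Finset.prod_filter, Fin.prod_univ_succ]
  simp

theorem weightUpTo_cons_succ (Pol : PolicyClass S A d ν) {n : ℕ} (θ₂ θ₁ : Param d) (x : S × A)
    (τ : Traj S A n) (k : Fin n) :
    Pol.weightUpTo θ₂ θ₁ (Fin.cons x τ : Traj S A (n + 1)) k.succ =
      Pol.π θ₁ x.1 x.2 / Pol.π θ₂ x.1 x.2 * Pol.weightUpTo θ₂ θ₁ τ k := by
  unfold weightUpTo
  rw [Finset.prod_filter, Finset.prod_filter, Fin.prod_univ_succ]
  simp [Fin.succ_le_succ_iff]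

theorem weightUpTo_pos (Pol : PolicyClass S A d ν) {n : ℕ} (θ₂ θ₁ : Param d) (τ : Traj S A n)
    (k : Fin n) : 0 < Pol.weightUpTo θ₂ θ₁ τ k :=
  Finset.prod_pos fun _ _ => div_pos (Pol.π_pos _ _ _) (Pol.π_pos _ _ _)

theorem measurable_weightUpTo (Pol : PolicyClass S A d ν) {n : ℕ} (θ₂ θ₁ : Param d) (k : Fin n) :
    Measurable fun τ : Traj S A n => Pol.weightUpTo θ₂ θ₁ τ k := by
  have hπ : ∀ (θ : Param d) j, Measurable fun τ : Traj S A n => Pol.π θ (τ j).1 (τ j).2 :=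
    fun θ j => Pol.measurable_π.comp (measurable_const.prodMk (measurable_pi_apply j))
  exact Finset.measurable_fun_prod _ fun j _ => (hπ θ₁ j).div (hπ θ₂ j)

end PolicyClass

/-! ### Change of measure and second moments of weights along trajectories -/

namespace EpisodicMDP

variable {S A : Type*} [MeasurableSpace S] [MeasurableSpace A] {d : ℕ} {ν : Measure A}

theorem measurable_cons_pair {n : ℕ} (x : S × A) :
    Measurable fun τ : Traj S A n => (Fin.cons x τ : Traj S A (n + 1)) := by
  refine measurable_pi_lambda _ fun i => ?_
  refine Fin.cases ?_ (fun j => ?_) i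
  · simp only [Fin.cons_zero]; fun_prop
  · simp only [Fin.cons_succ]; fun_prop

/-- The engine of all inductions on the horizon: it peels off the first state-action pair. Working
with Lebesgue integrals of nonnegative functions avoids integrability conditions at each stage. -/
theorem lintegral_rollout_succ [SigmaFinite ν] (𝓜 : EpisodicMDP S A) (Pol : PolicyClass S A d ν)
    (θ : Param d) (n : ℕ) (s : S) {F : Traj S A (n + 1) → ENNReal} (hF : Measurable F) :
    ∫⁻ τ, F τ ∂(𝓜.rollout Pol θ (n + 1) s) =
      ∫⁻ a, ∫⁻ s', ∫⁻ τ, F (Fin.cons (s, a) τ) ∂(𝓜.rollout Pol θ n s') ∂(𝓜.P (s, a))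
        ∂(Pol.actionLaw θ s) := by
  have := 𝓜.markov
  obtain ⟨ihp, ihm⟩ := 𝓜.measurable_rollout_aux Pol n
  have hmap : Measurable fun q : A × S => (𝓜.rollout Pol θ n q.2).map fun τ =>
      (Fin.cons (s, q.1) τ : Traj S A (n + 1)) := by
    refine measurable_map_param (fun q : A × S => 𝓜.rollout Pol θ n q.2)
      (ihm.comp (by fun_prop : Measurable fun q : A × S => (θ, q.2)))
      (fun q => ihp _ _) (fun q τ => (Fin.cons (s, q.1) τ : Traj S A (n + 1))) ?_
    refine measurable_pi_lambda _ fun i => ?_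
    refine Fin.cases ?_ (fun j => ?_) i
    · simp only [Fin.cons_zero]; fun_prop
    · simp only [Fin.cons_succ]; fun_prop
  have hin : Measurable fun a : A => (𝓜.P (s, a)).bind fun s' =>
      (𝓜.rollout Pol θ n s').map fun τ => (Fin.cons (s, a) τ : Traj S A (n + 1)) :=
    measurable_bind_param (fun a : A => 𝓜.P (s, a)) (𝓜.P.measurable.comp (by fun_prop))
      (fun q => inferInstance) _ hmap
  refine (Measure.lintegral_bind hin.aemeasurable hF.aemeasurable).trans
    (lintegral_congr fun a => ?_)
  refine (Measure.lintegral_bind (hmap.comp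
    (by fun_prop : Measurable fun s' : S => (a, s'))).aemeasurable hF.aemeasurable).trans ?_
  exact lintegral_congr fun s' => lintegral_map hF (measurable_cons_pair _)

theorem lintegral_trajLaw [SigmaFinite ν] (𝓜 : EpisodicMDP S A) (Pol : PolicyClass S A d ν)
    (θ : Param d) {F : Traj S A 𝓜.H → ENNReal} (hF : Measurable F) :
    ∫⁻ τ, F τ ∂(𝓜.trajLaw Pol θ) = ∫⁻ s, ∫⁻ τ, F τ ∂(𝓜.rollout Pol θ 𝓜.H s) ∂𝓜.ρ :=
  Measure.lintegral_bind ((𝓜.measurable_rollout_aux Pol 𝓜.H).2.comp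
    (by fun_prop : Measurable fun s : S => (θ, s))).aemeasurable hF.aemeasurable

/-- Change of measure for a function of a single state-action pair. -/
theorem lintegral_rollout_weight [SigmaFinite ν] (𝓜 : EpisodicMDP S A)
    (Pol : PolicyClass S A d ν) (θ₂ θ₁ : Param d) {φ : S × A → ENNReal} (hφ : Measurable φ)
    {n : ℕ} (h : Fin n) (s : S) :
    ∫⁻ τ, ENNReal.ofReal (Pol.weightUpTo θ₂ θ₁ τ h) * φ (τ h) ∂(𝓜.rollout Pol θ₂ n s) =
      ∫⁻ τ, φ (τ h) ∂(𝓜.rollout Pol θ₁ n s) := by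
  have := 𝓜.markov
  induction n generalizing s with
  | zero => exact h.elim0
  | succ n ih =>
    have h₁ : Measurable fun τ : Traj S A (n + 1) => φ (τ h) := hφ.comp (measurable_pi_apply h)
    have h₂ : Measurable fun τ : Traj S A (n + 1) =>
        ENNReal.ofReal (Pol.weightUpTo θ₂ θ₁ τ h) * φ (τ h) :=
      (Pol.measurable_weightUpTo θ₂ θ₁ h).ennreal_ofReal.mul h₁
    rw [𝓜.lintegral_rollout_succ Pol θ₂ n s h₂, 𝓜.lintegral_rollout_succ Pol θ₁ n s h₁, ← Pol.lintegral_actionLaw_ratio θ₂ θ₁ s]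
    refine lintegral_congr fun a => ?_
    have hp := (𝓜.measurable_rollout_aux Pol n).1
    refine Fin.cases ?_ (fun k => ?_) h
    · simp [PolicyClass.weightUpTo_cons_zero]
    · simp only [PolicyClass.weightUpTo_cons_succ, Fin.cons_succ]
      rw [← lintegral_const_mul' _ _ ENNReal.ofReal_ne_top]
      refine lintegral_congr fun s' => ?_
      rw [← ih k s', ← lintegral_const_mul' _ _ ENNReal.ofReal_ne_top]
      refine lintegral_congr fun τ => ?_
      rw [ENNReal.ofReal_mul (div_pos (Pol.π_pos _ _ _) (Pol.π_pos _ _ _)).le, mul_assoc]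

theorem lintegral_trajLaw_weight [SigmaFinite ν] (𝓜 : EpisodicMDP S A)
    (Pol : PolicyClass S A d ν) (θ₂ θ₁ : Param d) {φ : S × A → ENNReal} (hφ : Measurable φ)
    (h : Fin 𝓜.H) :
    ∫⁻ τ, ENNReal.ofReal (Pol.weightUpTo θ₂ θ₁ τ h) * φ (τ h) ∂(𝓜.trajLaw Pol θ₂) =
      ∫⁻ τ, φ (τ h) ∂(𝓜.trajLaw Pol θ₁) := by
  have h₁ : Measurable fun τ : Traj S A 𝓜.H => φ (τ h) := hφ.comp (measurable_pi_apply h)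
  have h₂ : Measurable fun τ : Traj S A 𝓜.H =>
      ENNReal.ofReal (Pol.weightUpTo θ₂ θ₁ τ h) * φ (τ h) :=
    (Pol.measurable_weightUpTo θ₂ θ₁ h).ennreal_ofReal.mul h₁
  rw [𝓜.lintegral_trajLaw Pol θ₂ h₂, 𝓜.lintegral_trajLaw Pol θ₁ h₁]
  exact lintegral_congr fun s => 𝓜.lintegral_rollout_weight Pol θ₂ θ₁ hφ h s

/-- If the second moment of every one-step importance ratio is at most `q`, then the second moment
of the importance weight of `h + 1` steps is at most `q ^ (h + 1)`. -/
theorem lintegral_rollout_weight_sq_le [SigmaFinite ν] (𝓜 : EpisodicMDP S A)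
    (Pol : PolicyClass S A d ν) (θ₂ θ₁ : Param d) {q : ENNReal}
    (hq : ∀ s, ∫⁻ a, ENNReal.ofReal ((Pol.π θ₁ s a / Pol.π θ₂ s a) ^ 2) ∂(Pol.actionLaw θ₂ s) ≤ q)
    {n : ℕ} (h : Fin n) (s : S) :
    ∫⁻ τ, ENNReal.ofReal (Pol.weightUpTo θ₂ θ₁ τ h ^ 2) ∂(𝓜.rollout Pol θ₂ n s) ≤
      q ^ ((h : ℕ) + 1) := by
  have := 𝓜.markov
  induction n generalizing s with
  | zero => exact h.elim0
  | succ n ih =>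
    rw [𝓜.lintegral_rollout_succ Pol θ₂ n s
      ((Pol.measurable_weightUpTo θ₂ θ₁ h).pow_const 2).ennreal_ofReal]
    have hp := (𝓜.measurable_rollout_aux Pol n).1
    refine Fin.cases ?_ (fun k => ?_) h
    · simpa [PolicyClass.weightUpTo_cons_zero] using hq s
    · simp only [PolicyClass.weightUpTo_cons_succ, mul_pow]
      -- The inductive bound on the remaining steps is uniform in the next state, so the transition
      -- kernel only averages a constant.
      calc _ ≤ ∫⁻ a, ENNReal.ofReal ((Pol.π θ₁ s a / Pol.π θ₂ s a) ^ 2) * q ^ ((k : ℕ) + 1)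
            ∂(Pol.actionLaw θ₂ s) := by
            refine lintegral_mono fun a => ?_
            calc _ ≤ ∫⁻ _, ENNReal.ofReal ((Pol.π θ₁ s a / Pol.π θ₂ s a) ^ 2) * q ^ ((k : ℕ) + 1)
                  ∂(𝓜.P (s, a)) := by
                  refine lintegral_mono fun s' => ?_
                  refine le_trans (le_of_eq ?_) (mul_le_mul_right (ih k s') _)
                  rw [← lintegral_const_mul' _ _ ENNReal.ofReal_ne_top]
                  exact lintegral_congr fun τ => ENNReal.ofReal_mul (sq_nonneg _)
              _ = _ := by simp
        _ = (∫⁻ a, ENNReal.ofReal ((Pol.π θ₁ s a / Pol.π θ₂ s a) ^ 2) ∂(Pol.actionLaw θ₂ s)) *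
            q ^ ((k : ℕ) + 1) := by
            refine lintegral_mul_const _ ?_
            refine ((Measurable.div ?_ ?_).pow_const 2).ennreal_ofReal
            · exact Pol.measurable_π.comp (by fun_prop : Measurable fun a : A => (θ₁, s, a))
            · exact Pol.measurable_π.comp (by fun_prop : Measurable fun a : A => (θ₂, s, a))
        _ ≤ q * q ^ ((k : ℕ) + 1) := mul_le_mul_left (hq s) _
        _ = _ := by rw [Fin.val_succ, pow_succ' q ((k : ℕ) + 1)]

theorem lintegral_trajLaw_weight_sq_le [SigmaFinite ν] (𝓜 : EpisodicMDP S A)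
    (Pol : PolicyClass S A d ν) (θ₂ θ₁ : Param d) {q : ENNReal}
    (hq : ∀ s, ∫⁻ a, ENNReal.ofReal ((Pol.π θ₁ s a / Pol.π θ₂ s a) ^ 2) ∂(Pol.actionLaw θ₂ s) ≤ q)
    (h : Fin 𝓜.H) :
    ∫⁻ τ, ENNReal.ofReal (Pol.weightUpTo θ₂ θ₁ τ h ^ 2) ∂(𝓜.trajLaw Pol θ₂) ≤
      q ^ ((h : ℕ) + 1) := by
  have := 𝓜.prob
  rw [𝓜.lintegral_trajLaw Pol θ₂ ((Pol.measurable_weightUpTo θ₂ θ₁ h).pow_const 2).ennreal_ofReal]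
  exact (lintegral_mono fun s => 𝓜.lintegral_rollout_weight_sq_le Pol θ₂ θ₁ hq h s).trans (by simp)

end EpisodicMDP

/-! ### Consequences of the bounds on the score and its derivative -/

namespace PolicyClass

variable {S A : Type*} [MeasurableSpace S] [MeasurableSpace A] {d : ℕ} {ν : Measure A}

/-- The score is bounded by `G`, differentiable in the parameter, and its derivative is bounded by
`M`. -/
structure IsSmooth (Pol : PolicyClass S A d ν) (G M : ℝ) : Prop where
  G_pos : 0 < G
  M_pos : 0 < M
  norm_score_le : ∀ θ s a, ‖Pol.score θ s a‖ ≤ G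
  differentiable_score : ∀ s a, Differentiable ℝ fun θ => Pol.score θ s a
  norm_fderiv_score_le : ∀ θ s a, ‖fderiv ℝ (fun θ' => Pol.score θ' s a) θ‖ ≤ M

theorem hasGradientAt_log (Pol : PolicyClass S A d ν) (θ : Param d) (s : S) (a : A) :
    HasGradientAt (fun θ' => Real.log (Pol.π θ' s a)) (Pol.score θ s a) θ :=
  (((Pol.differentiable_π s a) θ).log (Pol.π_pos θ s a).ne').hasGradientAt

/-- This quotient form carries differentiability from ∇π to the score, which is what the Hessian
bound is about. -/
theorem score_eq (Pol : PolicyClass S A d ν) (θ : Param d) (s : S) (a : A) :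
    Pol.score θ s a = (Pol.π θ s a)⁻¹ • gradient (fun θ' => Pol.π θ' s a) θ := by
  refine (Pol.hasGradientAt_log θ s a).unique ?_
  have h := ((Pol.differentiable_π s a) θ).hasGradientAt.hasFDerivAt.log (Pol.π_pos θ s a).ne'
  rw [hasGradientAt_iff_hasFDerivAt]
  refine h.congr_fderiv ?_
  ext
  simp

theorem differentiable_score_of_gradient (Pol : PolicyClass S A d ν)
    (hdiff : ∀ s a, Differentiable ℝ (gradient fun θ => Pol.π θ s a)) (s : S) (a : A) :
    Differentiable ℝ fun θ => Pol.score θ s a := by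
  simp only [score_eq]
  exact ((Pol.differentiable_π s a).inv fun θ => (Pol.π_pos θ s a).ne').smul (hdiff s a)

variable {Pol : PolicyClass S A d ν} {G M : ℝ}

theorem IsSmooth.abs_log_sub_le (hP : Pol.IsSmooth G M) (θ₂ θ₁ : Param d) (s : S) (a : A) :
    |Real.log (Pol.π θ₁ s a) - Real.log (Pol.π θ₂ s a)| ≤ G * ‖θ₁ - θ₂‖ := by
  refine convex_univ.norm_image_sub_le_of_norm_hasFDerivWithin_le
    (f := fun θ' => Real.log (Pol.π θ' s a))
    (fun θ _ => (Pol.hasGradientAt_log θ s a).hasFDerivAt.hasFDerivWithinAt) (fun θ _ => ?_)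
    (Set.mem_univ _) (Set.mem_univ _)
  simpa using hP.norm_score_le θ s a

theorem IsSmooth.norm_score_sub_le (hP : Pol.IsSmooth G M) (θ₂ θ₁ : Param d) (s : S) (a : A) :
    ‖Pol.score θ₁ s a - Pol.score θ₂ s a‖ ≤ M * ‖θ₁ - θ₂‖ :=
  convex_univ.norm_image_sub_le_of_norm_fderiv_le
    (fun θ _ => hP.differentiable_score s a θ) (fun θ _ => hP.norm_fderiv_score_le θ s a)
    (Set.mem_univ _) (Set.mem_univ _)

theorem ratio_eq_exp (Pol : PolicyClass S A d ν) (θ₂ θ₁ : Param d) (s : S) (a : A) :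
    Pol.π θ₁ s a / Pol.π θ₂ s a =
      Real.exp (Real.log (Pol.π θ₁ s a) - Real.log (Pol.π θ₂ s a)) := by
  rw [Real.exp_sub, Real.exp_log (Pol.π_pos _ _ _), Real.exp_log (Pol.π_pos _ _ _)]

theorem IsSmooth.ratio_le (hP : Pol.IsSmooth G M) (θ₂ θ₁ : Param d) (s : S) (a : A) :
    Pol.π θ₁ s a / Pol.π θ₂ s a ≤ Real.exp (G * ‖θ₁ - θ₂‖) := by
  rw [ratio_eq_exp]
  exact Real.exp_le_exp.2 (abs_le.1 (hP.abs_log_sub_le θ₂ θ₁ s a)).2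

theorem IsSmooth.le_ratio (hP : Pol.IsSmooth G M) (θ₂ θ₁ : Param d) (s : S) (a : A) :
    Real.exp (-(G * ‖θ₁ - θ₂‖)) ≤ Pol.π θ₁ s a / Pol.π θ₂ s a := by
  rw [ratio_eq_exp]
  exact Real.exp_le_exp.2 (abs_le.1 (hP.abs_log_sub_le θ₂ θ₁ s a)).1

/-- The second moment of a one-step importance ratio, from its pointwise bounds and its mean. -/
theorem IsSmooth.lintegral_ratio_sq_le (hP : Pol.IsSmooth G M) (θ₂ θ₁ : Param d) (s : S) :
    ∫⁻ a, ENNReal.ofReal ((Pol.π θ₁ s a / Pol.π θ₂ s a) ^ 2) ∂(Pol.actionLaw θ₂ s) ≤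
      ENNReal.ofReal (2 * Real.cosh (G * ‖θ₁ - θ₂‖) - 1) := by
  set y := G * ‖θ₁ - θ₂‖
  have hp₁ := Pol.isProbabilityMeasure_actionLaw θ₁ s
  have hp₂ := Pol.isProbabilityMeasure_actionLaw θ₂ s
  have hc := Real.one_le_cosh y
  -- A ratio r in [e^{-y}, e^y] satisfies (e^y - r)(r - e^{-y}) ≥ 0, that is, r² + 1 ≤ 2 cosh(y) r.
  -- Integrating and using that r has mean 1 gives the claim.
  have h1 : ∫⁻ a, (ENNReal.ofReal ((Pol.π θ₁ s a / Pol.π θ₂ s a) ^ 2) + 1)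
      ∂(Pol.actionLaw θ₂ s) ≤ ENNReal.ofReal (2 * Real.cosh y) := by
    calc _ ≤ ∫⁻ a, ENNReal.ofReal (Pol.π θ₁ s a / Pol.π θ₂ s a) * ENNReal.ofReal (2 * Real.cosh y)
          ∂(Pol.actionLaw θ₂ s) := by
          refine lintegral_mono fun a => ?_
          have h3 := hP.ratio_le θ₂ θ₁ s a
          have h4 := hP.le_ratio θ₂ θ₁ s a
          have h5 : 0 < Pol.π θ₁ s a / Pol.π θ₂ s a := div_pos (Pol.π_pos _ _ _) (Pol.π_pos _ _ _)
          rw [← ENNReal.ofReal_one, ← ENNReal.ofReal_add (sq_nonneg _) zero_le_one,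
            ← ENNReal.ofReal_mul h5.le]
          refine ENNReal.ofReal_le_ofReal ?_
          have h6 : Real.exp y * Real.exp (-y) = 1 := by rw [← Real.exp_add]; simp
          rw [Real.cosh_eq]
          nlinarith [mul_nonneg (sub_nonneg.2 h3) (sub_nonneg.2 h4)]
      _ = _ := by
          rw [Pol.lintegral_actionLaw_ratio]
          simp
  rw [lintegral_add_right _ measurable_const] at h1
  simp only [lintegral_one, measure_univ] at h1
  rw [ENNReal.ofReal_sub _ zero_le_one, ENNReal.ofReal_one]
  exact ENNReal.le_sub_of_add_le_right ENNReal.one_ne_top h1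

section Traj

variable {H : ℕ}

theorem card_filter_le_fin (h : Fin H) :
    (Finset.univ.filter fun z : Fin H => z ≤ h).card = (h : ℕ) + 1 := by
  rw [← Fin.card_Iic h]
  congr 1
  ext
  simp

theorem IsSmooth.norm_scoreSum_le (hP : Pol.IsSmooth G M) (θ : Param d) (τ : Traj S A H)
    (h : Fin H) : ‖Pol.scoreSum θ τ h‖ ≤ ((h : ℝ) + 1) * G := by
  unfold scoreSum
  refine (norm_sum_le_of_le _ fun z _ => hP.norm_score_le θ (τ z).1 (τ z).2).trans ?_
  simp [card_filter_le_fin]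

theorem IsSmooth.norm_scoreSum_sub_le (hP : Pol.IsSmooth G M) (θ₂ θ₁ : Param d) (τ : Traj S A H)
    (h : Fin H) :
    ‖Pol.scoreSum θ₁ τ h - Pol.scoreSum θ₂ τ h‖ ≤ ((h : ℝ) + 1) * (M * ‖θ₁ - θ₂‖) := by
  unfold scoreSum
  rw [← Finset.sum_sub_distrib]
  refine (norm_sum_le_of_le _ fun z _ => hP.norm_score_sub_le θ₂ θ₁ (τ z).1 (τ z).2).trans ?_
  simp [card_filter_le_fin]

theorem IsSmooth.weightUpTo_le (hP : Pol.IsSmooth G M) (θ₂ θ₁ : Param d) (τ : Traj S A H)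
    (h : Fin H) : Pol.weightUpTo θ₂ θ₁ τ h ≤ Real.exp (G * ‖θ₁ - θ₂‖) ^ ((h : ℕ) + 1) := by
  unfold weightUpTo
  refine (Finset.prod_le_prod (fun j _ => (div_pos (Pol.π_pos _ _ _) (Pol.π_pos _ _ _)).le)
    fun j _ => hP.ratio_le θ₂ θ₁ (τ j).1 (τ j).2).trans ?_
  rw [Finset.prod_const, card_filter_le_fin]

theorem weightUpTo_eq_exp (Pol : PolicyClass S A d ν) (θ₂ θ₁ : Param d) (τ : Traj S A H)
    (h : Fin H) : Pol.weightUpTo θ₂ θ₁ τ h = Real.exp (∑ j ∈ Finset.univ.filter (fun j => j ≤ h),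
      (Real.log (Pol.π θ₁ (τ j).1 (τ j).2) - Real.log (Pol.π θ₂ (τ j).1 (τ j).2))) := by
  unfold weightUpTo
  rw [Real.exp_sum]
  exact Finset.prod_congr rfl fun j _ => ratio_eq_exp _ _ _ _ _

/-- The log-derivative trick: the weight is the exponential of a sum of log-ratios, and only the
numerators depend on the variable, so the inner derivative is the sum of scores. -/
theorem hasFDerivAt_weightUpTo (Pol : PolicyClass S A d ν) (θ₂ θ : Param d) (τ : Traj S A H)
    (h : Fin H) : HasFDerivAt (fun θ' => Pol.weightUpTo θ₂ θ' τ h)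
      (Pol.weightUpTo θ₂ θ τ h • innerSL ℝ (Pol.scoreSum θ τ h)) θ := by
  have h1 := (HasFDerivAt.fun_sum (u := Finset.univ.filter (fun j : Fin H => j ≤ h)) fun j _ =>
    ((Pol.hasGradientAt_log θ (τ j).1 (τ j).2).hasFDerivAt.sub_const
      (Real.log (Pol.π θ₂ (τ j).1 (τ j).2)))).exp
  simp only [weightUpTo_eq_exp]
  refine h1.congr_fderiv ?_
  ext
  simp [scoreSum]

@[simp]
theorem weightUpTo_self (Pol : PolicyClass S A d ν) (θ : Param d) (τ : Traj S A H) (h : Fin H) :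
    Pol.weightUpTo θ θ τ h = 1 :=
  Finset.prod_eq_one fun _ _ => div_self (Pol.π_pos _ _ _).ne'

end Traj

end PolicyClass

/-! ### Discounted sums and the deviation of a product of ratios -/

section Series

theorem sum_geometric_le {x : ℝ} (h0 : 0 ≤ x) (h1 : x < 1) (n : ℕ) :
    ∑ h : Fin n, x ^ (h : ℕ) ≤ 1 / (1 - x) := by
  rw [Fin.sum_univ_eq_sum_range (fun i => x ^ i)]
  rw [one_div]
  exact sum_le_hasSum _ (fun i _ => by positivity) (hasSum_geometric_of_lt_one h0 h1)

theorem sum_succ_mul_geometric_le {x : ℝ} (h0 : 0 ≤ x) (h1 : x < 1) (n : ℕ) :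
    ∑ h : Fin n, ((h : ℝ) + 1) * x ^ (h : ℕ) ≤ 1 / (1 - x) ^ 2 := by
  rw [Fin.sum_univ_eq_sum_range (fun i => ((i : ℝ) + 1) * x ^ i)]
  have h := hasSum_choose_mul_geometric_of_norm_lt_one 1
    (by rwa [Real.norm_of_nonneg h0] : ‖x‖ < 1)
  simp only [Nat.choose_one_right, Nat.cast_add, Nat.cast_one] at h
  exact sum_le_hasSum _ (fun i _ => by positivity) h

/-- The coefficients are binomial(h+2, 2). They arise as h+1, from the number of scores, times
(h+2)/2, from `weightDev`. -/
theorem sum_choose_two_mul_geometric_le {x : ℝ} (h0 : 0 ≤ x) (h1 : x < 1) (n : ℕ) :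
    ∑ h : Fin n, ((h : ℝ) + 1) * (((h : ℝ) + 2) / 2) * x ^ (h : ℕ) ≤ 1 / (1 - x) ^ 3 := by
  rw [Fin.sum_univ_eq_sum_range (fun i => ((i : ℝ) + 1) * (((i : ℝ) + 2) / 2) * x ^ i)]
  have h := hasSum_choose_mul_geometric_of_norm_lt_one 2
    (by rwa [Real.norm_of_nonneg h0] : ‖x‖ < 1)
  refine sum_le_hasSum _ (fun i _ => by positivity) (h.congr_fun fun i => ?_)
  rw [Nat.cast_choose_two]
  push_cast
  ring

/-- The left side is (a - 1)(1 + a + ... + a^h), and each of the h+1 powers is at most a^h. -/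
theorem pow_succ_sub_one_le {a : ℝ} (ha : 1 ≤ a) (h : ℕ) :
    a ^ (h + 1) - 1 ≤ ((h : ℝ) + 1) * (a - 1) * a ^ h := by
  induction h with
  | zero => simp
  | succ h ih =>
    have h1 : a * (a ^ (h + 1) - 1) ≤ a * (((h : ℝ) + 1) * (a - 1) * a ^ h) :=
      mul_le_mul_of_nonneg_left ih (by linarith)
    have h2 : (a - 1) * 1 ≤ (a - 1) * a ^ (h + 1) :=
      mul_le_mul_of_nonneg_left (one_le_pow₀ ha) (by linarith)
    have e1 : a ^ (h + 1 + 1) = a * a ^ (h + 1) := by ring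
    have e2 : a * (((h : ℝ) + 1) * (a - 1) * a ^ h) = ((h : ℝ) + 1) * (a - 1) * a ^ (h + 1) := by
      ring
    push_cast
    linarith

/-- The bound on the standard deviation of an importance weight of `h + 1` steps. -/
noncomputable def weightDev (t : ℝ) (h : ℕ) : ℝ := t * (((h : ℝ) + 2) / 2) * (1 + t ^ 2 / 2) ^ h

theorem weightDev_pos {t : ℝ} (ht : 0 < t) (h : ℕ) : 0 < weightDev t h := by
  unfold weightDev
  positivity

/-- Exact squares are created from 1 + t² ≤ (1 + t²/2)² and h + 1 ≤ ((h+2)/2)², so that the standard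
deviation is a polynomial in h times a power and can be summed against γ^h in closed form. -/
theorem pow_sub_one_le_weightDev_sq (t : ℝ) (h : ℕ) :
    (1 + t ^ 2) ^ (h + 1) - 1 ≤ weightDev t h ^ 2 := by
  have h1 := pow_succ_sub_one_le (by nlinarith : 1 ≤ 1 + t ^ 2) h
  have h2 : (1 + t ^ 2) ^ h ≤ ((1 + t ^ 2 / 2) ^ 2) ^ h :=
    pow_le_pow_left₀ (by positivity) (by nlinarith [sq_nonneg (t ^ 2)]) h
  have h3 : (h : ℝ) + 1 ≤ (((h : ℝ) + 2) / 2) ^ 2 := by nlinarith [sq_nonneg (h : ℝ)]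
  calc _ ≤ ((h : ℝ) + 1) * (1 + t ^ 2 - 1) * (1 + t ^ 2) ^ h := h1
    _ = ((h : ℝ) + 1) * (t ^ 2 * (1 + t ^ 2) ^ h) := by ring
    _ ≤ (((h : ℝ) + 2) / 2) ^ 2 * (t ^ 2 * ((1 + t ^ 2 / 2) ^ 2) ^ h) := by gcongr
    _ = weightDev t h ^ 2 := by
      unfold weightDev
      rw [← pow_mul, mul_comm 2 h, pow_mul]
      ring

end Series

/-! ### Mean and variance of the importance weights -/

namespace EpisodicMDP

variable {S A : Type*} [MeasurableSpace S] [MeasurableSpace A] {d : ℕ} {ν : Measure A}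
  [SigmaFinite ν] (𝓜 : EpisodicMDP S A) {Pol : PolicyClass S A d ν} {G M : ℝ}

theorem integral_trajLaw (Pol : PolicyClass S A d ν) (θ : Param d) {f : Traj S A 𝓜.H → ℝ}
    (hf : Measurable f) {C : ℝ} (hC : ∀ τ, |f τ| ≤ C) :
    ∫ τ, f τ ∂(𝓜.trajLaw Pol θ) = ∫ s, ∫ τ, f τ ∂(𝓜.rollout Pol θ 𝓜.H s) ∂𝓜.ρ := by
  have hp := 𝓜.isProbabilityMeasure_trajLaw Pol θ
  -- Bundling the rollouts as a kernel presents the trajectory law as a composition, for which the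
  -- Bochner iterated-integral formula holds.
  let K : Kernel S (Traj S A 𝓜.H) := ⟨fun s => 𝓜.rollout Pol θ 𝓜.H s,
    (𝓜.measurable_rollout_aux Pol 𝓜.H).2.comp (by fun_prop : Measurable fun s : S => (θ, s))⟩
  have e : 𝓜.trajLaw Pol θ = (K ∘ₖ Kernel.const Unit 𝓜.ρ) () :=
    Measure.comp_eq_comp_const_apply (κ := K)
  have hi : Integrable f (𝓜.trajLaw Pol θ) :=
    Integrable.of_bound hf.aestronglyMeasurable C (ae_of_all _ hC)
  rw [e] at hi ⊢
  rw [Kernel.integral_comp hi]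
  rfl

theorem integrable_trajLaw (Pol : PolicyClass S A d ν) (θ : Param d) {E : Type*}
    [NormedAddCommGroup E] [MeasurableSpace E] [BorelSpace E] [SecondCountableTopology E]
    {f : Traj S A 𝓜.H → E} (hf : Measurable f) {C : ℝ}
    (hC : ∀ τ, ‖f τ‖ ≤ C) : Integrable f (𝓜.trajLaw Pol θ) :=
  have := 𝓜.isProbabilityMeasure_trajLaw Pol θ
  Integrable.of_bound hf.aestronglyMeasurable C (ae_of_all _ hC)

/-- The nonnegative case is the change of measure for Lebesgue integrals. A bounded φ reduces to it
by adding its bound C, and the contribution of C cancels because the weight has mean 1. -/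
theorem integral_weight_mul (hP : Pol.IsSmooth G M) (θ₂ θ₁ : Param d) {φ : S × A → ℝ}
    (hφ : Measurable φ) {C : ℝ} (hC : ∀ x, |φ x| ≤ C) (h : Fin 𝓜.H) :
    ∫ τ, Pol.weightUpTo θ₂ θ₁ τ h * φ (τ h) ∂(𝓜.trajLaw Pol θ₂) =
      ∫ τ, φ (τ h) ∂(𝓜.trajLaw Pol θ₁) := by
  have hp₁ := 𝓜.isProbabilityMeasure_trajLaw Pol θ₁
  have hev : Measurable fun τ : Traj S A 𝓜.H => τ h := measurable_pi_apply h
  have hw := Pol.measurable_weightUpTo θ₂ θ₁ h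
  have key : ∀ ψ : S × A → ℝ, Measurable ψ → (∀ x, 0 ≤ ψ x) →
      ∫ τ, Pol.weightUpTo θ₂ θ₁ τ h * ψ (τ h) ∂(𝓜.trajLaw Pol θ₂) =
        ∫ τ, ψ (τ h) ∂(𝓜.trajLaw Pol θ₁) := by
    intro ψ hψ h0
    rw [integral_eq_lintegral_of_nonneg_ae
        (ae_of_all _ fun τ => mul_nonneg (Pol.weightUpTo_pos _ _ _ _).le (h0 _))
        (hw.mul (hψ.comp hev)).aestronglyMeasurable,
      integral_eq_lintegral_of_nonneg_ae (ae_of_all _ fun τ => h0 _)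
        (hψ.comp hev).aestronglyMeasurable,
      ← 𝓜.lintegral_trajLaw_weight Pol θ₂ θ₁ hψ.ennreal_ofReal h]
    congr 1
    exact lintegral_congr fun τ => ENNReal.ofReal_mul (Pol.weightUpTo_pos _ _ _ _).le
  have hwi : Integrable (fun τ => Pol.weightUpTo θ₂ θ₁ τ h) (𝓜.trajLaw Pol θ₂) :=
    𝓜.integrable_trajLaw Pol θ₂ hw fun τ => by
      rw [Real.norm_of_nonneg (Pol.weightUpTo_pos _ _ _ _).le]
      exact hP.weightUpTo_le θ₂ θ₁ τ h
  have hφi : ∀ θ, Integrable (fun τ => φ (τ h)) (𝓜.trajLaw Pol θ) := fun θ =>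
    𝓜.integrable_trajLaw Pol θ (hφ.comp hev) fun τ => hC _
  have hwφ : Integrable (fun τ => Pol.weightUpTo θ₂ θ₁ τ h * φ (τ h)) (𝓜.trajLaw Pol θ₂) :=
    hwi.mul_bdd (hφ.comp hev).aestronglyMeasurable (ae_of_all _ fun τ => hC _)
  have e1 := key (fun x => φ x + C) (hφ.add_const C) fun x => by linarith [(abs_le.1 (hC x)).1]
  have e2 := key (fun _ => 1) measurable_const fun x => zero_le_one
  simp only [mul_add] at e1
  rw [integral_add hwφ (hwi.mul_const C), integral_add (hφi θ₁) (integrable_const C),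
    integral_mul_const] at e1
  simp only [mul_one, integral_const, probReal_univ, smul_eq_mul, one_mul] at e1 e2
  rw [e2] at e1
  linarith

theorem integral_weight (hP : Pol.IsSmooth G M) (θ₂ θ₁ : Param d) (h : Fin 𝓜.H) :
    ∫ τ, Pol.weightUpTo θ₂ θ₁ τ h ∂(𝓜.trajLaw Pol θ₂) = 1 := by
  have := 𝓜.isProbabilityMeasure_trajLaw Pol θ₁
  simpa using 𝓜.integral_weight_mul hP θ₂ θ₁ (φ := fun _ => 1) measurable_const (C := 1)
    (by simp) h

/-- The variance of an importance weight. -/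
theorem integral_weight_sub_one_sq_le (hP : Pol.IsSmooth G M) (θ₂ θ₁ : Param d) {t : ℝ}
    (ht : 2 * Real.cosh (G * ‖θ₁ - θ₂‖) - 2 ≤ t ^ 2) (h : Fin 𝓜.H) :
    ∫ τ, |Pol.weightUpTo θ₂ θ₁ τ h - 1| ^ 2 ∂(𝓜.trajLaw Pol θ₂) ≤ weightDev t h ^ 2 := by
  have := 𝓜.isProbabilityMeasure_trajLaw Pol θ₂
  have hw := Pol.measurable_weightUpTo θ₂ θ₁ h
  have hb : ∀ τ, ‖Pol.weightUpTo θ₂ θ₁ τ h‖ ≤ Real.exp (G * ‖θ₁ - θ₂‖) ^ ((h : ℕ) + 1) :=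
    fun τ => by
      rw [Real.norm_of_nonneg (Pol.weightUpTo_pos _ _ _ _).le]
      exact hP.weightUpTo_le θ₂ θ₁ τ h
  have hwi := 𝓜.integrable_trajLaw Pol θ₂ hw hb
  have hwi2 : Integrable (fun τ => Pol.weightUpTo θ₂ θ₁ τ h ^ 2) (𝓜.trajLaw Pol θ₂) :=
    𝓜.integrable_trajLaw Pol θ₂ (hw.pow_const 2) fun τ => by
      rw [norm_pow]
      exact pow_le_pow_left₀ (norm_nonneg _) (hb τ) 2
  have e : ∀ τ : Traj S A 𝓜.H, |Pol.weightUpTo θ₂ θ₁ τ h - 1| ^ 2 =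
      Pol.weightUpTo θ₂ θ₁ τ h ^ 2 - 2 * Pol.weightUpTo θ₂ θ₁ τ h + 1 := fun τ => by
    rw [sq_abs]; ring
  have hs : Integrable (fun τ => Pol.weightUpTo θ₂ θ₁ τ h ^ 2 - 2 * Pol.weightUpTo θ₂ θ₁ τ h)
      (𝓜.trajLaw Pol θ₂) := hwi2.sub (hwi.const_mul 2)
  simp only [e]
  rw [integral_add hs (integrable_const 1),
    integral_sub hwi2 (hwi.const_mul 2), integral_const_mul, 𝓜.integral_weight hP]
  have h2 : ∫ τ, Pol.weightUpTo θ₂ θ₁ τ h ^ 2 ∂(𝓜.trajLaw Pol θ₂) ≤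
      (1 + t ^ 2) ^ ((h : ℕ) + 1) := by
    rw [integral_eq_lintegral_of_nonneg_ae (ae_of_all _ fun τ => sq_nonneg _)
      (hw.pow_const 2).aestronglyMeasurable]
    refine ENNReal.toReal_le_of_le_ofReal (by positivity) ?_
    rw [ENNReal.ofReal_pow (by positivity)]
    refine 𝓜.lintegral_trajLaw_weight_sq_le Pol θ₂ θ₁ (fun s => ?_) h
    exact (hP.lintegral_ratio_sq_le θ₂ θ₁ s).trans (ENNReal.ofReal_le_ofReal (by linarith))
  have h3 := pow_sub_one_le_weightDev_sq t h
  simp only [integral_const, probReal_univ, smul_eq_mul, one_mul]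
  linarith

end EpisodicMDP

/-! ### Pointwise estimator bounds and the policy gradient theorem -/

namespace EpisodicMDP

variable {S A : Type*} [MeasurableSpace S] [MeasurableSpace A] {d : ℕ} {ν : Measure A}
  (𝓜 : EpisodicMDP S A) {Pol : PolicyClass S A d ν} {G M : ℝ}

theorem abs_discounted_reward_le (τ : Traj S A 𝓜.H) (h : Fin 𝓜.H) :
    |𝓜.γ ^ (h : ℕ) * 𝓜.r (τ h).1 (τ h).2| ≤ 𝓜.γ ^ (h : ℕ) * 𝓜.R := by
  have := 𝓜.γ_pos
  rw [abs_mul, abs_of_nonneg (by positivity)]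
  exact mul_le_mul_of_nonneg_left (𝓜.abs_r_le _ _) (by positivity)

theorem measurable_ret : Measurable 𝓜.ret :=
  Finset.measurable_fun_sum _ fun h _ =>
    (𝓜.measurable_r.comp (measurable_pi_apply h)).const_mul _

theorem abs_ret_le (τ : Traj S A 𝓜.H) : |𝓜.ret τ| ≤ 𝓜.R / (1 - 𝓜.γ) := by
  unfold ret
  refine (Finset.abs_sum_le_sum_abs _ _).trans
    ((Finset.sum_le_sum fun h _ => 𝓜.abs_discounted_reward_le τ h).trans ?_)
  rw [← Finset.sum_mul]
  refine (mul_le_mul_of_nonneg_right (sum_geometric_le 𝓜.γ_pos.le 𝓜.γ_lt_one _)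
    𝓜.R_pos.le).trans (le_of_eq (by ring))

theorem norm_gpomdp_le (hP : Pol.IsSmooth G M) (θ : Param d) (τ : Traj S A 𝓜.H) :
    ‖𝓜.gpomdp Pol θ τ‖ ≤ G * 𝓜.R / (1 - 𝓜.γ) ^ 2 := by
  have hG := hP.G_pos
  have hR := 𝓜.R_pos
  have hγ := 𝓜.γ_pos
  unfold gpomdp
  calc _ ≤ ∑ h : Fin 𝓜.H, 𝓜.γ ^ (h : ℕ) * 𝓜.R * (((h : ℝ) + 1) * G) := by
        refine norm_sum_le_of_le _ fun h _ => ?_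
        rw [norm_smul]
        exact mul_le_mul (𝓜.abs_discounted_reward_le τ h) (hP.norm_scoreSum_le θ τ h)
          (norm_nonneg _) (by positivity)
    _ = G * 𝓜.R * ∑ h : Fin 𝓜.H, ((h : ℝ) + 1) * 𝓜.γ ^ (h : ℕ) := by
        rw [Finset.mul_sum]
        exact Finset.sum_congr rfl fun h _ => by ring
    _ ≤ G * 𝓜.R * (1 / (1 - 𝓜.γ) ^ 2) :=
        mul_le_mul_of_nonneg_left (sum_succ_mul_geometric_le hγ.le 𝓜.γ_lt_one _) (by positivity)
    _ = _ := by ring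

/-- A crude bound on the off-policy estimator for parameters at distance at most `D`. -/
noncomputable def offBound (G D : ℝ) : ℝ :=
  ∑ h : Fin 𝓜.H, Real.exp (G * D) ^ ((h : ℕ) + 1) * (𝓜.γ ^ (h : ℕ) * 𝓜.R) * (((h : ℝ) + 1) * G)

theorem norm_gpomdpOff_le (hP : Pol.IsSmooth G M) (θ₂ θ₁ : Param d) {D : ℝ}
    (hD : ‖θ₁ - θ₂‖ ≤ D) (τ : Traj S A 𝓜.H) :
    ‖𝓜.gpomdpOff Pol θ₂ θ₁ τ‖ ≤ 𝓜.offBound G D := by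
  have hG := hP.G_pos
  have hR := 𝓜.R_pos
  have hγ := 𝓜.γ_pos
  refine norm_sum_le_of_le _ fun h _ => ?_
  rw [norm_smul, norm_mul]
  refine mul_le_mul (mul_le_mul ?_ (𝓜.abs_discounted_reward_le τ h) (norm_nonneg _)
    (by positivity)) (hP.norm_scoreSum_le θ₁ τ h) (norm_nonneg _) (by positivity)
  rw [Real.norm_of_nonneg (Pol.weightUpTo_pos _ _ _ _).le]
  refine (hP.weightUpTo_le θ₂ θ₁ τ h).trans ?_
  gcongr

theorem gpomdpOff_self (θ : Param d) (τ : Traj S A 𝓜.H) :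
    𝓜.gpomdpOff Pol θ θ τ = 𝓜.gpomdp Pol θ τ := by
  simp [gpomdpOff, gpomdp]

theorem measurable_gpomdp_apply (Pol : PolicyClass S A d ν) (θ : Param d) :
    Measurable fun τ => 𝓜.gpomdp Pol θ τ :=
  𝓜.measurable_gpomdp Pol measurable_const measurable_id

theorem measurable_gpomdpOff_apply (Pol : PolicyClass S A d ν) (θ₂ θ₁ : Param d) :
    Measurable fun τ => 𝓜.gpomdpOff Pol θ₂ θ₁ τ :=
  𝓜.measurable_gpomdpOff Pol measurable_const measurable_const measurable_id

/-- Pointwise comparison of the on-policy and the off-policy estimator. -/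
theorem norm_gpomdp_sub_gpomdpOff_le (hP : Pol.IsSmooth G M) (θ₂ θ₁ : Param d)
    (τ : Traj S A 𝓜.H) :
    ‖𝓜.gpomdp Pol θ₂ τ - 𝓜.gpomdpOff Pol θ₂ θ₁ τ‖ ≤
      ∑ h : Fin 𝓜.H, 𝓜.γ ^ (h : ℕ) * 𝓜.R * ((h : ℝ) + 1) *
        (M * ‖θ₁ - θ₂‖ + G * |Pol.weightUpTo θ₂ θ₁ τ h - 1|) := by
  have hG := hP.G_pos
  have hR := 𝓜.R_pos
  have hγ := 𝓜.γ_pos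
  unfold gpomdp gpomdpOff
  rw [← Finset.sum_sub_distrib]
  refine norm_sum_le_of_le _ fun h _ => ?_
  set w := Pol.weightUpTo θ₂ θ₁ τ h
  set c := 𝓜.γ ^ (h : ℕ) * 𝓜.r (τ h).1 (τ h).2
  -- The difference splits into a change of scores, of deterministic size M‖θ₁ - θ₂‖ per step, and a
  -- deviation of the weight from 1.
  have e : c • Pol.scoreSum θ₂ τ h - (w * c) • Pol.scoreSum θ₁ τ h =
      -(c • ((Pol.scoreSum θ₁ τ h - Pol.scoreSum θ₂ τ h) + (w - 1) • Pol.scoreSum θ₁ τ h)) := by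
    module
  rw [e, norm_neg, norm_smul, mul_assoc]
  refine mul_le_mul (𝓜.abs_discounted_reward_le τ h) ?_ (norm_nonneg _) (by positivity)
  refine (norm_add_le _ _).trans ?_
  rw [norm_smul, Real.norm_eq_abs]
  have h1 := hP.norm_scoreSum_sub_le θ₂ θ₁ τ h
  have h2 := mul_le_mul_of_nonneg_left (hP.norm_scoreSum_le θ₁ τ h) (abs_nonneg (w - 1))
  linarith

/-- The return with every reward multiplied by the importance weight up to its time. -/
noncomputable def weightedRet (Pol : PolicyClass S A d ν) (θ₂ θ₁ : Param d) (τ : Traj S A 𝓜.H) : ℝ :=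
  ∑ h : Fin 𝓜.H, Pol.weightUpTo θ₂ θ₁ τ h * (𝓜.γ ^ (h : ℕ) * 𝓜.r (τ h).1 (τ h).2)

theorem measurable_weightedRet (Pol : PolicyClass S A d ν) (θ₂ θ₁ : Param d) :
    Measurable (𝓜.weightedRet Pol θ₂ θ₁) :=
  Finset.measurable_fun_sum _ fun h _ => (Pol.measurable_weightUpTo θ₂ θ₁ h).mul
    ((𝓜.measurable_r.comp (measurable_pi_apply h)).const_mul _)

variable [SigmaFinite ν]

theorem integrable_gpomdp (hP : Pol.IsSmooth G M) (θ : Param d) :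
    Integrable (fun τ => 𝓜.gpomdp Pol θ τ) (𝓜.trajLaw Pol θ) :=
  𝓜.integrable_trajLaw Pol θ (𝓜.measurable_gpomdp_apply Pol θ) (𝓜.norm_gpomdp_le hP θ)

theorem integrable_gpomdpOff (hP : Pol.IsSmooth G M) (θ₂ θ₁ : Param d) :
    Integrable (fun τ => 𝓜.gpomdpOff Pol θ₂ θ₁ τ) (𝓜.trajLaw Pol θ₂) :=
  𝓜.integrable_trajLaw Pol θ₂ (𝓜.measurable_gpomdpOff_apply Pol θ₂ θ₁)
    (𝓜.norm_gpomdpOff_le hP θ₂ θ₁ le_rfl)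

theorem value_eq (Pol : PolicyClass S A d ν) (θ : Param d) :
    𝓜.value Pol θ = ∫ τ, 𝓜.ret τ ∂(𝓜.trajLaw Pol θ) :=
  (𝓜.integral_trajLaw Pol θ 𝓜.measurable_ret 𝓜.abs_ret_le).symm

theorem abs_value_le (Pol : PolicyClass S A d ν) (θ : Param d) :
    |𝓜.value Pol θ| ≤ 𝓜.R / (1 - 𝓜.γ) := by
  have := 𝓜.isProbabilityMeasure_trajLaw Pol θ
  rw [value_eq]
  simpa using norm_integral_le_of_norm_le_const (μ := 𝓜.trajLaw Pol θ) (f := 𝓜.ret)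
    (ae_of_all _ 𝓜.abs_ret_le)

theorem integrable_weightedRet_term (hP : Pol.IsSmooth G M) (θ₂ θ₁ : Param d) (h : Fin 𝓜.H) :
    Integrable (fun τ => Pol.weightUpTo θ₂ θ₁ τ h * (𝓜.γ ^ (h : ℕ) * 𝓜.r (τ h).1 (τ h).2))
      (𝓜.trajLaw Pol θ₂) := by
  refine 𝓜.integrable_trajLaw Pol θ₂
    (C := Real.exp (G * ‖θ₁ - θ₂‖) ^ ((h : ℕ) + 1) * (𝓜.γ ^ (h : ℕ) * 𝓜.R)) ((Pol.measurable_weightUpTo θ₂ θ₁ h).mul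
    ((𝓜.measurable_r.comp (measurable_pi_apply h)).const_mul _)) fun τ => ?_
  rw [norm_mul]
  refine mul_le_mul ?_ (𝓜.abs_discounted_reward_le τ h) (norm_nonneg _) (by positivity)
  rw [Real.norm_of_nonneg (Pol.weightUpTo_pos _ _ _ _).le]
  exact hP.weightUpTo_le θ₂ θ₁ τ h

theorem integrable_weightedRet (hP : Pol.IsSmooth G M) (θ₂ θ₁ : Param d) :
    Integrable (𝓜.weightedRet Pol θ₂ θ₁) (𝓜.trajLaw Pol θ₂) :=
  integrable_finsetSum _ fun h _ => 𝓜.integrable_weightedRet_term hP θ₂ θ₁ h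

/-- The reward at time h depends on the h-th pair only, so the weight truncated at h suffices. The
measure on the right no longer involves θ₁, which permits differentiation under the integral. -/
theorem value_eq_weightedRet (hP : Pol.IsSmooth G M) (θ₂ θ₁ : Param d) :
    𝓜.value Pol θ₁ = ∫ τ, 𝓜.weightedRet Pol θ₂ θ₁ τ ∂(𝓜.trajLaw Pol θ₂) := by
  have hφ : ∀ h : Fin 𝓜.H, Measurable fun x : S × A => 𝓜.γ ^ (h : ℕ) * 𝓜.r x.1 x.2 :=
    fun h => 𝓜.measurable_r.const_mul _
  have hC : ∀ (h : Fin 𝓜.H) (x : S × A), |𝓜.γ ^ (h : ℕ) * 𝓜.r x.1 x.2| ≤ 𝓜.γ ^ (h : ℕ) * 𝓜.R :=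
    fun h x => 𝓜.abs_discounted_reward_le (fun _ => x) h
  have hi : ∀ h : Fin 𝓜.H, Integrable (fun τ : Traj S A 𝓜.H =>
      𝓜.γ ^ (h : ℕ) * 𝓜.r (τ h).1 (τ h).2) (𝓜.trajLaw Pol θ₁) := fun h =>
    𝓜.integrable_trajLaw Pol θ₁ ((hφ h).comp (measurable_pi_apply h)) fun τ => hC h _
  rw [value_eq]
  unfold weightedRet ret
  rw [integral_finsetSum _ fun h _ => 𝓜.integrable_weightedRet_term hP θ₂ θ₁ h,
    integral_finsetSum _ fun h _ => hi h]
  exact Finset.sum_congr rfl fun h _ => (𝓜.integral_weight_mul hP θ₂ θ₁ (hφ h) (hC h) h).symm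

/-- The policy gradient theorem: off-policy GPOMDP is an unbiased estimator of `∇ V`. -/
theorem hasGradientAt_value (hP : Pol.IsSmooth G M) (θ₂ θ : Param d) :
    HasGradientAt (𝓜.value Pol) (∫ τ, 𝓜.gpomdpOff Pol θ₂ θ τ ∂(𝓜.trajLaw Pol θ₂)) θ := by
  have hp := 𝓜.isProbabilityMeasure_trajLaw Pol θ₂
  have hv : 𝓜.value Pol = fun θ' => ∫ τ, 𝓜.weightedRet Pol θ₂ θ' τ ∂(𝓜.trajLaw Pol θ₂) :=
    funext (𝓜.value_eq_weightedRet hP θ₂)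
  have hd : ∀ (τ : Traj S A 𝓜.H) (θ' : Param d), HasFDerivAt
      (fun θ'' => 𝓜.weightedRet Pol θ₂ θ'' τ) (innerSL ℝ (𝓜.gpomdpOff Pol θ₂ θ' τ)) θ' := by
    intro τ θ'
    have h1 := HasFDerivAt.fun_sum (u := Finset.univ) fun (h : Fin 𝓜.H) _ =>
      (Pol.hasFDerivAt_weightUpTo θ₂ θ' τ h).mul_const (𝓜.γ ^ (h : ℕ) * 𝓜.r (τ h).1 (τ h).2)
    refine h1.congr_fderiv ?_
    ext v
    simp only [gpomdpOff, map_sum, map_smul, sum_apply,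
      smul_apply, smul_eq_mul]
    exact Finset.sum_congr rfl fun h _ => by ring
  have hi := 𝓜.integrable_gpomdpOff hP θ₂ θ
  -- On the unit ball around θ the distance to θ₂ is at most 1 + ‖θ - θ₂‖, so a constant dominates
  -- the derivatives.
  have key := hasFDerivAt_integral_of_dominated_of_fderiv_le (μ := 𝓜.trajLaw Pol θ₂)
    (F := fun θ' τ => 𝓜.weightedRet Pol θ₂ θ' τ)
    (F' := fun θ' τ => innerSL ℝ (𝓜.gpomdpOff Pol θ₂ θ' τ))
    (bound := fun _ => 𝓜.offBound G (1 + ‖θ - θ₂‖)) (Metric.ball_mem_nhds θ one_pos)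
    (Filter.Eventually.of_forall fun θ' =>
      (𝓜.measurable_weightedRet Pol θ₂ θ').aestronglyMeasurable)
    (𝓜.integrable_weightedRet hP θ₂ θ)
    ((innerSL ℝ).continuous.comp_aestronglyMeasurable hi.aestronglyMeasurable)
    (ae_of_all _ fun τ θ' hθ' => ?_) (integrable_const _)
    (ae_of_all _ fun τ θ' _ => hd τ θ')
  · rw [hasGradientAt_iff_hasFDerivAt, hv]
    refine key.congr_fderiv ?_
    rw [ContinuousLinearMap.integral_comp_comm _ hi]
    rfl
  · rw [innerSL_apply_norm]
    refine 𝓜.norm_gpomdpOff_le hP θ₂ θ' ?_ τ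
    rw [Metric.mem_ball, dist_eq_norm] at hθ'
    calc ‖θ' - θ₂‖ = ‖(θ' - θ) + (θ - θ₂)‖ := by congr 1; abel
      _ ≤ ‖θ' - θ‖ + ‖θ - θ₂‖ := norm_add_le _ _
      _ ≤ _ := by linarith

theorem differentiable_value (hP : Pol.IsSmooth G M) : Differentiable ℝ (𝓜.value Pol) :=
  fun θ => (𝓜.hasGradientAt_value hP θ θ).differentiableAt

theorem integral_gpomdpOff (hP : Pol.IsSmooth G M) (θ₂ θ : Param d) :
    ∫ τ, 𝓜.gpomdpOff Pol θ₂ θ τ ∂(𝓜.trajLaw Pol θ₂) = gradient (𝓜.value Pol) θ :=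
  (𝓜.hasGradientAt_value hP θ₂ θ).gradient.symm

theorem integral_gpomdp (hP : Pol.IsSmooth G M) (θ : Param d) :
    ∫ τ, 𝓜.gpomdp Pol θ τ ∂(𝓜.trajLaw Pol θ) = gradient (𝓜.value Pol) θ := by
  simpa only [gpomdpOff_self] using 𝓜.integral_gpomdpOff hP θ θ

theorem norm_gradient_value_le (hP : Pol.IsSmooth G M) (θ : Param d) :
    ‖gradient (𝓜.value Pol) θ‖ ≤ G * 𝓜.R / (1 - 𝓜.γ) ^ 2 := by
  have := 𝓜.isProbabilityMeasure_trajLaw Pol θ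
  rw [← 𝓜.integral_gpomdp hP]
  simpa using norm_integral_le_of_norm_le_const (μ := 𝓜.trajLaw Pol θ)
    (ae_of_all _ (𝓜.norm_gpomdp_le hP θ))

end EpisodicMDP

/-! ### Auxiliary analysis: cosh, Lipschitz bounds, the descent lemma -/

theorem two_mul_cosh_sub_two_le {y : ℝ} (hy : y ^ 2 ≤ 105 / 64) :
    2 * Real.cosh y - 2 ≤ (11 / 10 * y) ^ 2 := by
  have h0 : 0 ≤ y ^ 2 := sq_nonneg y
  -- Halving the argument twice leaves cosh(y/4) ≤ exp(y²/32) ≤ 1/(1 - y²/32), which is sharp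
  -- enough; the duplication formula then carries the quadratic bound back up to y.
  have d1 : Real.cosh y = 2 * Real.cosh (y / 2) ^ 2 - 1 := by
    have := Real.cosh_two_mul (y / 2)
    rw [mul_div_cancel₀ _ two_ne_zero, Real.sinh_sq] at this
    linarith
  have d2 : Real.cosh (y / 2) = 2 * Real.cosh (y / 4) ^ 2 - 1 := by
    have := Real.cosh_two_mul (y / 4)
    rw [show 2 * (y / 4) = y / 2 by ring, Real.sinh_sq] at this
    linarith
  have h1 : Real.cosh (y / 4) ≤ 1 + 0.03295 * y ^ 2 := by
    refine (Real.cosh_le_exp_half_sq _).trans ?_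
    have h2 := Real.exp_bound_div_one_sub_of_interval (x := (y / 4) ^ 2 / 2) (by positivity)
      (by nlinarith)
    refine h2.trans ?_
    rw [div_le_iff₀ (by nlinarith)]
    nlinarith
  have h2 := Real.one_le_cosh (y / 4)
  have h3 : Real.cosh (y / 2) ≤ 1 + 0.13539 * y ^ 2 := by
    rw [d2]
    have : Real.cosh (y / 4) ^ 2 ≤ (1 + 0.03295 * y ^ 2) ^ 2 := pow_le_pow_left₀ (by linarith) h1 2
    nlinarith
  have h4 := Real.one_le_cosh (y / 2)
  rw [d1]
  have : Real.cosh (y / 2) ^ 2 ≤ (1 + 0.13539 * y ^ 2) ^ 2 := pow_le_pow_left₀ (by linarith) h3 2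
  nlinarith

/-- Cut the segment from y to x into n equal pieces of length at most ε and add up the increments.
-/
theorem norm_sub_le_of_locally {E F : Type*} [NormedAddCommGroup E] [NormedSpace ℝ E]
    [NormedAddCommGroup F] {f : E → F} {L ε : ℝ} (hε : 0 < ε)
    (h : ∀ x y, ‖x - y‖ ≤ ε → ‖f x - f y‖ ≤ L * ‖x - y‖) (x y : E) :
    ‖f x - f y‖ ≤ L * ‖x - y‖ := by
  obtain ⟨n, hn⟩ := exists_nat_gt (‖x - y‖ / ε)
  have hn0 : (0 : ℝ) < n := lt_of_le_of_lt (by positivity) hn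
  set δ : E := (n : ℝ)⁻¹ • (x - y) with hδ
  have hδn : ‖δ‖ = ‖x - y‖ / n := by
    rw [hδ, norm_smul, norm_inv, Real.norm_natCast]; ring
  have hδε : ‖δ‖ ≤ ε := by
    rw [hδn, div_le_iff₀ hn0]
    rw [div_lt_iff₀ hε] at hn
    linarith
  have step : ∀ k : ℕ, ‖f (y + (k : ℝ) • δ) - f y‖ ≤ k * (L * ‖δ‖) := by
    intro k
    induction k with
    | zero => simp
    | succ k ih =>
      have e : y + ((k + 1 : ℕ) : ℝ) • δ - (y + (k : ℝ) • δ) = δ := by push_cast; module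
      have h1 := h (y + ((k + 1 : ℕ) : ℝ) • δ) (y + (k : ℝ) • δ) (by rwa [e])
      rw [e] at h1
      have h2 := norm_sub_le_norm_sub_add_norm_sub (f (y + ((k + 1 : ℕ) : ℝ) • δ))
        (f (y + (k : ℝ) • δ)) (f y)
      push_cast at h1 h2 ⊢
      linarith
  have h3 := step n
  have e : y + (n : ℝ) • δ = x := by
    rw [hδ, smul_inv_smul₀ hn0.ne']; abel
  rw [e, hδn] at h3
  refine h3.trans (le_of_eq ?_)
  field_simp

/-- The descent lemma, as a lower bound. -/
theorem le_of_lipschitz_gradient {E : Type*} [NormedAddCommGroup E] [InnerProductSpace ℝ E]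
    [CompleteSpace E] {V : E → ℝ} {L : ℝ} (hV : Differentiable ℝ V)
    (hL : ∀ x y, ‖gradient V x - gradient V y‖ ≤ L * ‖x - y‖) (x δ : E) :
    V x + inner ℝ (gradient V x) δ - L / 2 * ‖δ‖ ^ 2 ≤ V (x + δ) := by
  -- φ is V along the segment minus its linear part, plus a quadratic that compensates the Lipschitz
  -- error of the gradient; hence its derivative is nonnegative, and φ(0) ≤ φ(1) is the claim.
  let φ : ℝ → ℝ := fun u => V (x + u • δ) - u * inner ℝ (gradient V x) δ + L / 2 * ‖δ‖ ^ 2 * u ^ 2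
  have hline : ∀ u : ℝ, HasDerivAt (fun u : ℝ => x + u • δ) δ u := fun u => by
    simpa using ((hasDerivAt_id u).smul_const δ).const_add x
  have hφ : ∀ u, HasDerivAt φ (inner ℝ (gradient V (x + u • δ) - gradient V x) δ +
      L * u * ‖δ‖ ^ 2) u := by
    intro u
    have h1 := (hV (x + u • δ)).hasGradientAt.hasFDerivAt.comp_hasDerivAt u (hline u)
    have h2 := (h1.sub ((hasDerivAt_id u).mul_const (inner ℝ (gradient V x) δ))).add
      (((hasDerivAt_id u).pow 2).const_mul (L / 2 * ‖δ‖ ^ 2))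
    refine h2.congr_deriv ?_
    simp only [InnerProductSpace.toDual_apply_apply, inner_sub_left, id, Nat.cast_ofNat]
    ring
  have hmono : MonotoneOn φ (Set.Icc 0 1) := by
    refine monotoneOn_of_deriv_nonneg (convex_Icc 0 1)
      (fun u _ => (hφ u).continuousAt.continuousWithinAt)
      (fun u _ => (hφ u).differentiableAt.differentiableWithinAt) fun u hu => ?_
    rw [interior_Icc] at hu
    rw [(hφ u).deriv]
    have h1 := abs_real_inner_le_norm (gradient V (x + u • δ) - gradient V x) δ
    have h2 := hL (x + u • δ) x
    rw [add_sub_cancel_left, norm_smul, Real.norm_of_nonneg hu.1.le] at h2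
    have h3 := mul_le_mul_of_nonneg_right h2 (norm_nonneg δ)
    have h4 := (abs_le.1 h1).1
    nlinarith
  have h := hmono (Set.left_mem_Icc.2 zero_le_one) (Set.right_mem_Icc.2 zero_le_one) zero_le_one
  simp only [φ, zero_smul, one_smul, add_zero] at h
  linarith

theorem sq_integral_le {Ω : Type*} [MeasurableSpace Ω] {μ : Measure Ω} [IsProbabilityMeasure μ]
    {X : Ω → ℝ} (hX : MemLp X 2 μ) : (∫ ω, X ω ∂μ) ^ 2 ≤ ∫ ω, X ω ^ 2 ∂μ := by
  have h := variance_nonneg X μ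
  rw [variance_eq_sub hX] at h
  simpa using h

/-! ### On-policy versus off-policy estimator, and smoothness of V -/

namespace EpisodicMDP

variable {S A : Type*} [MeasurableSpace S] [MeasurableSpace A] {d : ℕ} {ν : Measure A}
  (𝓜 : EpisodicMDP S A) {Pol : PolicyClass S A d ν} {G M : ℝ}

theorem constL_pos (hG : 0 < G) (hM : 0 < M) : 0 < 𝓜.constL G M := by
  have := 𝓜.R_pos
  have := sub_pos.2 𝓜.γ_lt_one
  unfold constL
  positivity

variable [SigmaFinite ν]

/-- This is Minkowski's inequality in L², carried out as a weighted Cauchy–Schwarz: the squared sum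
is at most (∑ f)(∑ g), where f h is the bound on the L² norm of the h-th term and g h is a random
majorant with mean at most f h. -/
theorem integral_norm_gpomdp_sub_sq_le (hP : Pol.IsSmooth G M) (θ₂ θ₁ : Param d) {t : ℝ}
    (ht0 : 0 < t) (ht : 2 * Real.cosh (G * ‖θ₁ - θ₂‖) - 2 ≤ t ^ 2)
    (hz : 𝓜.γ * (1 + t ^ 2 / 2) < 1) :
    ∫ τ, ‖𝓜.gpomdp Pol θ₂ τ - 𝓜.gpomdpOff Pol θ₂ θ₁ τ‖ ^ 2 ∂(𝓜.trajLaw Pol θ₂) ≤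
      (𝓜.R * (M * ‖θ₁ - θ₂‖ / (1 - 𝓜.γ) ^ 2 +
        G * t / (1 - 𝓜.γ * (1 + t ^ 2 / 2)) ^ 3)) ^ 2 := by
  have hG := hP.G_pos
  have hM := hP.M_pos
  have hR := 𝓜.R_pos
  have hγ := 𝓜.γ_pos
  have hp := 𝓜.isProbabilityMeasure_trajLaw Pol θ₂
  set m := M * ‖θ₁ - θ₂‖
  have hm : 0 ≤ m := by positivity
  set c : Fin 𝓜.H → ℝ := fun h => 𝓜.γ ^ (h : ℕ) * 𝓜.R * ((h : ℝ) + 1)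
  have hc : ∀ h, 0 ≤ c h := fun h => by positivity
  set Y : Fin 𝓜.H → Traj S A 𝓜.H → ℝ := fun h τ => |Pol.weightUpTo θ₂ θ₁ τ h - 1|
  have hY : ∀ h τ, 0 ≤ Y h τ := fun h τ => abs_nonneg _
  have hw : ∀ h : Fin 𝓜.H, 0 < weightDev t h := fun h => weightDev_pos ht0 h
  set f : Fin 𝓜.H → ℝ := fun h => c h * (m + G * weightDev t h)
  have hf : ∀ h, 0 ≤ f h := fun h => mul_nonneg (hc h) (by have := hw h; positivity)
  set g : Fin 𝓜.H → Traj S A 𝓜.H → ℝ := fun h τ => c h * (m + G * (Y h τ ^ 2 / weightDev t h))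
  have hg : ∀ h τ, 0 ≤ g h τ := fun h τ =>
    mul_nonneg (hc h) (by have := hw h; have := hY h τ; positivity)
  have hYi : ∀ h, Integrable (fun τ => Y h τ ^ 2) (𝓜.trajLaw Pol θ₂) := fun h => by
    refine 𝓜.integrable_trajLaw Pol θ₂
      (C := (Real.exp (G * ‖θ₁ - θ₂‖) ^ ((h : ℕ) + 1) + 1) ^ 2)
      (((Pol.measurable_weightUpTo θ₂ θ₁ h).sub_const 1).abs.pow_const 2) fun τ => ?_
    rw [norm_pow, Real.norm_of_nonneg (hY h τ)]
    refine pow_le_pow_left₀ (hY h τ) ((abs_sub _ _).trans ?_) 2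
    rw [abs_of_pos (Pol.weightUpTo_pos _ _ _ _), abs_one]
    have := hP.weightUpTo_le θ₂ θ₁ τ h
    linarith
  have hgi : ∀ h, Integrable (g h) (𝓜.trajLaw Pol θ₂) := fun h =>
    ((integrable_const m).add (((hYi h).div_const _).const_mul G)).const_mul (c h)
  have hgE : ∀ h, ∫ τ, g h τ ∂(𝓜.trajLaw Pol θ₂) ≤ f h := fun h => by
    rw [integral_const_mul, integral_add (integrable_const m) (((hYi h).div_const _).const_mul G),
      integral_const_mul G, integral_div]
    refine mul_le_mul_of_nonneg_left ?_ (hc h)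
    have h1 := 𝓜.integral_weight_sub_one_sq_le hP θ₂ θ₁ ht h
    have h2 : (∫ τ, Y h τ ^ 2 ∂(𝓜.trajLaw Pol θ₂)) / weightDev t h ≤ weightDev t h := by
      rw [div_le_iff₀ (hw h), ← sq]
      exact h1
    simp only [integral_const, probReal_univ, smul_eq_mul, one_mul]
    have := mul_le_mul_of_nonneg_left h2 hG.le
    linarith
  have hpt : ∀ τ, ‖𝓜.gpomdp Pol θ₂ τ - 𝓜.gpomdpOff Pol θ₂ θ₁ τ‖ ^ 2 ≤
      (∑ h, f h) * ∑ h, g h τ := fun τ => by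
    refine (pow_le_pow_left₀ (norm_nonneg _)
      (𝓜.norm_gpomdp_sub_gpomdpOff_le hP θ₂ θ₁ τ) 2).trans ?_
    refine Finset.sum_sq_le_sum_mul_sum_of_sq_le_mul _ (fun h _ => hf h) (fun h _ => hg h τ)
      fun h _ => ?_
    have h1 := hw h
    -- AM-GM with the deviation bound as weight; it handles the cross term in (m + G Y)² ≤ (m + G
    -- w)(m + G Y²/w), where w is `weightDev t h`.
    have h2 : 2 * Y h τ ≤ weightDev t h + Y h τ ^ 2 / weightDev t h := by
      have := sq_nonneg (weightDev t h - Y h τ)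
      rw [← sub_nonneg]
      have e : weightDev t h + Y h τ ^ 2 / weightDev t h - 2 * Y h τ =
          (weightDev t h - Y h τ) ^ 2 / weightDev t h := by
        field_simp
        ring
      rw [e]
      positivity
    have e : f h * g h τ - (c h * (m + G * Y h τ)) ^ 2 = c h ^ 2 * (m * G *
        (weightDev t h + Y h τ ^ 2 / weightDev t h - 2 * Y h τ)) := by
      simp only [f, g]
      field_simp
      ring
    have h3 : 0 ≤ c h ^ 2 * (m * G *
        (weightDev t h + Y h τ ^ 2 / weightDev t h - 2 * Y h τ)) := by
      have := sub_nonneg.2 h2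
      positivity
    change (c h * (m + G * Y h τ)) ^ 2 ≤ f h * g h τ
    linarith
  have hS : ∑ h, f h ≤ 𝓜.R * (m / (1 - 𝓜.γ) ^ 2 + G * t / (1 - 𝓜.γ * (1 + t ^ 2 / 2)) ^ 3) := by
    have s1 := mul_le_mul_of_nonneg_left
      (sum_succ_mul_geometric_le hγ.le 𝓜.γ_lt_one 𝓜.H) (by positivity : 0 ≤ 𝓜.R * m)
    have s2 := mul_le_mul_of_nonneg_left
      (sum_choose_two_mul_geometric_le (by positivity) hz 𝓜.H) (by positivity : 0 ≤ 𝓜.R * (G * t))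
    have e : ∑ h, f h = 𝓜.R * m * (∑ h : Fin 𝓜.H, ((h : ℝ) + 1) * 𝓜.γ ^ (h : ℕ)) +
        𝓜.R * (G * t) * ∑ h : Fin 𝓜.H, ((h : ℝ) + 1) * (((h : ℝ) + 2) / 2) *
          (𝓜.γ * (1 + t ^ 2 / 2)) ^ (h : ℕ) := by
      rw [Finset.mul_sum, Finset.mul_sum, ← Finset.sum_add_distrib]
      refine Finset.sum_congr rfl fun h _ => ?_
      simp only [f, c, weightDev, mul_pow]
      ring
    rw [e]
    refine (add_le_add s1 s2).trans (le_of_eq ?_)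
    ring
  have hf0 : 0 ≤ ∑ h, f h := Finset.sum_nonneg fun h _ => hf h
  calc _ ≤ ∫ τ, (∑ h, f h) * ∑ h, g h τ ∂(𝓜.trajLaw Pol θ₂) :=
        integral_mono_of_nonneg (ae_of_all _ fun τ => by positivity)
          ((integrable_finsetSum _ fun h _ => hgi h).const_mul _) (ae_of_all _ hpt)
    _ = (∑ h, f h) * ∑ h, ∫ τ, g h τ ∂(𝓜.trajLaw Pol θ₂) := by
        rw [integral_const_mul, integral_finsetSum _ fun h _ => hgi h]
    _ ≤ (∑ h, f h) * ∑ h, f h :=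
        mul_le_mul_of_nonneg_left (Finset.sum_le_sum fun h _ => hgE h) hf0
    _ = (∑ h, f h) ^ 2 := (sq _).symm
    _ ≤ _ := pow_le_pow_left₀ hf0 hS 2


/-- Second moment of the difference of the on-policy and the off-policy estimator, for parameters
within a multiple of `(1 - γ) / G`. -/
theorem integral_norm_gpomdp_sub_sq_le_of_near (hP : Pol.IsSmooth G M) {θ₂ θ₁ : Param d}
    {b c : ℝ} (hb : (G * ‖θ₁ - θ₂‖) ^ 2 ≤ b * (1 - 𝓜.γ) ^ 2) (hb' : b ≤ 105 / 64)
    (hc0 : 0 < c) (hc : c ≤ 1 - 121 / 800 * b) :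
    ∫ τ, ‖𝓜.gpomdp Pol θ₂ τ - 𝓜.gpomdpOff Pol θ₂ θ₁ τ‖ ^ 2 ∂(𝓜.trajLaw Pol θ₂) ≤
      (‖θ₁ - θ₂‖ * (M * 𝓜.R / (1 - 𝓜.γ) ^ 2 +
        11 / 10 / c ^ 3 * (G ^ 2 * 𝓜.R / (1 - 𝓜.γ) ^ 3))) ^ 2 := by
  have hG := hP.G_pos
  have hM := hP.M_pos
  have hR := 𝓜.R_pos
  have hγ := 𝓜.γ_pos
  have hκ := sub_pos.2 𝓜.γ_lt_one
  -- The general estimate needs t > 0, so coinciding parameters are treated apart; there the two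
  -- estimators agree.
  rcases eq_or_ne θ₁ θ₂ with rfl | hne
  · simp [gpomdpOff_self]
  have hΔ : 0 < ‖θ₁ - θ₂‖ := norm_pos_iff.2 (sub_ne_zero.2 hne)
  set y := G * ‖θ₁ - θ₂‖ with hy
  have hy0 : 0 < y := by positivity
  have hb0 : 0 < b := by
    by_contra h
    have : b * (1 - 𝓜.γ) ^ 2 ≤ 0 := mul_nonpos_of_nonpos_of_nonneg (not_lt.1 h) (by positivity)
    have : 0 < y ^ 2 := by positivity
    linarith
  have hκ1 : (1 - 𝓜.γ) ^ 2 ≤ 1 := by nlinarith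
  have hyb : y ^ 2 ≤ 105 / 64 := by nlinarith
  -- With t = 11y/10, the loss γt²/2 equals (121/200)γy². Since γ(1-γ) ≤ 1/4, it is at most
  -- (121/800) b (1-γ), which explains the condition on c.
  have hz : c * (1 - 𝓜.γ) ≤ 1 - 𝓜.γ * (1 + (11 / 10 * y) ^ 2 / 2) := by
    have h1 : 𝓜.γ * (1 - 𝓜.γ) ≤ 1 / 4 := by nlinarith [sq_nonneg (𝓜.γ - 1 / 2)]
    have h2 : 𝓜.γ * y ^ 2 ≤ 1 / 4 * (b * (1 - 𝓜.γ)) :=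
      calc 𝓜.γ * y ^ 2 ≤ 𝓜.γ * (b * (1 - 𝓜.γ) ^ 2) := mul_le_mul_of_nonneg_left hb hγ.le
        _ = 𝓜.γ * (1 - 𝓜.γ) * (b * (1 - 𝓜.γ)) := by ring
        _ ≤ _ := mul_le_mul_of_nonneg_right h1 (by positivity)
    have h3 := mul_le_mul_of_nonneg_right hc hκ.le
    linarith
  have hcκ : 0 < c * (1 - 𝓜.γ) := by positivity
  refine (𝓜.integral_norm_gpomdp_sub_sq_le hP θ₂ θ₁ (t := 11 / 10 * y) (by positivity)
    (two_mul_cosh_sub_two_le hyb) (by linarith)).trans ?_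
  have h4 : G * (11 / 10 * y) / (1 - 𝓜.γ * (1 + (11 / 10 * y) ^ 2 / 2)) ^ 3 ≤
      G * (11 / 10 * y) / (c * (1 - 𝓜.γ)) ^ 3 := by gcongr
  refine pow_le_pow_left₀ (mul_nonneg hR.le (add_nonneg (by positivity) (div_nonneg
    (by positivity) (pow_nonneg (by linarith) 3)))) ?_ 2
  refine (mul_le_mul_of_nonneg_left (add_le_add_right h4 _) hR.le).trans (le_of_eq ?_)
  rw [hy]
  field_simp

/-- The radius is the one supplied by `step_le_of_lyapunov_le`. Here c = 3/4 is admissible and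
(11/10)/c³ is below 2√2, so a factor 2 on L² suffices. -/
theorem integral_norm_gpomdp_sub_sq_le_two_mul (hP : Pol.IsSmooth G M) {θ₂ θ₁ : Param d}
    (h : (G * ‖θ₁ - θ₂‖) ^ 2 ≤ 105 / 64 * (1 - 𝓜.γ) ^ 2) :
    ∫ τ, ‖𝓜.gpomdp Pol θ₂ τ - 𝓜.gpomdpOff Pol θ₂ θ₁ τ‖ ^ 2 ∂(𝓜.trajLaw Pol θ₂) ≤
      2 * 𝓜.constL G M ^ 2 * ‖θ₁ - θ₂‖ ^ 2 := by
  have hM := hP.M_pos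
  have hR := 𝓜.R_pos
  have hκ := sub_pos.2 𝓜.γ_lt_one
  refine (𝓜.integral_norm_gpomdp_sub_sq_le_of_near hP h le_rfl
    (c := 3 / 4) (by norm_num) (by norm_num)).trans ?_
  have e : 𝓜.constL G M = M * 𝓜.R / (1 - 𝓜.γ) ^ 2 + 2 * (G ^ 2 * 𝓜.R / (1 - 𝓜.γ) ^ 3) := by
    unfold constL; ring
  rw [e]
  have hp : 0 ≤ M * 𝓜.R / (1 - 𝓜.γ) ^ 2 := by positivity
  have hq : 0 ≤ G ^ 2 * 𝓜.R / (1 - 𝓜.γ) ^ 3 := by positivity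
  generalize M * 𝓜.R / (1 - 𝓜.γ) ^ 2 = P at *
  generalize G ^ 2 * 𝓜.R / (1 - 𝓜.γ) ^ 3 = Q at *
  rw [mul_pow, mul_comm]
  refine mul_le_mul_of_nonneg_right ?_ (sq_nonneg _)
  norm_num
  nlinarith [mul_nonneg hp hq, mul_nonneg hp hp, mul_nonneg hq hq]

/-- Both gradients are means under the same law p(·|θ₂), so Jensen's inequality reduces the claim to
the second-moment bound. At distance at most (1-γ)/(2G) one may take c = 9/10, and (11/10)/c³ ≤ 2
yields exactly L; subdivision removes the restriction on the distance. -/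
theorem norm_gradient_value_sub_le (hP : Pol.IsSmooth G M) (θ₁ θ₂ : Param d) :
    ‖gradient (𝓜.value Pol) θ₁ - gradient (𝓜.value Pol) θ₂‖ ≤ 𝓜.constL G M * ‖θ₁ - θ₂‖ := by
  have hG := hP.G_pos
  have hM := hP.M_pos
  have hR := 𝓜.R_pos
  have hκ := sub_pos.2 𝓜.γ_lt_one
  have hL := 𝓜.constL_pos hG hM
  refine norm_sub_le_of_locally (ε := (1 - 𝓜.γ) / (2 * G)) (by positivity) (fun θ₁ θ₂ hd => ?_)
    θ₁ θ₂
  have hp := 𝓜.isProbabilityMeasure_trajLaw Pol θ₂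
  have hy : (G * ‖θ₁ - θ₂‖) ^ 2 ≤ 1 / 4 * (1 - 𝓜.γ) ^ 2 := by
    have h1 : G * ‖θ₁ - θ₂‖ ≤ (1 - 𝓜.γ) / 2 :=
      (mul_le_mul_of_nonneg_left hd hG.le).trans (le_of_eq (by field_simp))
    refine (pow_le_pow_left₀ (by positivity) h1 2).trans (le_of_eq (by ring))
  have h2 := 𝓜.integral_norm_gpomdp_sub_sq_le_of_near hP hy (by norm_num) (c := 9 / 10)
    (by norm_num) (by norm_num)
  rw [norm_sub_rev, ← 𝓜.integral_gpomdp hP θ₂, ← 𝓜.integral_gpomdpOff hP θ₂ θ₁,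
    ← integral_sub (𝓜.integrable_gpomdp hP θ₂) (𝓜.integrable_gpomdpOff hP θ₂ θ₁)]
  have hm : Measurable fun τ => ‖𝓜.gpomdp Pol θ₂ τ - 𝓜.gpomdpOff Pol θ₂ θ₁ τ‖ :=
    ((𝓜.measurable_gpomdp_apply Pol θ₂).sub (𝓜.measurable_gpomdpOff_apply Pol θ₂ θ₁)).norm
  have h3 := sq_integral_le (μ := 𝓜.trajLaw Pol θ₂) (MemLp.of_bound hm.aestronglyMeasurable
    (G * 𝓜.R / (1 - 𝓜.γ) ^ 2 + 𝓜.offBound G ‖θ₁ - θ₂‖) (ae_of_all _ fun τ => by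
      rw [norm_norm]
      exact (norm_sub_le _ _).trans (add_le_add (𝓜.norm_gpomdp_le hP θ₂ τ)
        (𝓜.norm_gpomdpOff_le hP θ₂ θ₁ le_rfl τ))))
  refine (norm_integral_le_integral_norm _).trans ?_
  refine ((le_abs_self _).trans (abs_le_of_sq_le_sq (h3.trans h2) (by positivity))).trans ?_
  rw [mul_comm]
  refine mul_le_mul_of_nonneg_right ?_ (norm_nonneg _)
  have e : 𝓜.constL G M = M * 𝓜.R / (1 - 𝓜.γ) ^ 2 + 2 * (G ^ 2 * 𝓜.R / (1 - 𝓜.γ) ^ 3) := by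
    unfold constL; ring
  rw [e]
  have hq : 0 ≤ G ^ 2 * 𝓜.R / (1 - 𝓜.γ) ^ 3 := by positivity
  gcongr
  norm_num

theorem continuous_gradient_value (hP : Pol.IsSmooth G M) :
    Continuous (gradient (𝓜.value Pol)) := by
  have hL := 𝓜.constL_pos hP.G_pos hP.M_pos
  refine (LipschitzWith.of_dist_le_mul (K := (𝓜.constL G M).toNNReal) fun θ₁ θ₂ => ?_).continuous
  rw [dist_eq_norm, dist_eq_norm, Real.coe_toNNReal _ hL.le]
  exact 𝓜.norm_gradient_value_sub_le hP θ₁ θ₂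

end EpisodicMDP

/-! ### Second moments of averages of independent centered vectors -/

section Average

variable {Ω : Type*} [MeasurableSpace Ω] {μ : Measure Ω} [IsProbabilityMeasure μ]

/-- The cross term vanishes by centering and the variances add by independence. The shift c is there
for the error inherited from the previous estimate. -/
theorem integral_const_add_average_sq {X : Ω → ℝ} (hX : MemLp X 2 μ) (h0 : ∫ ω, X ω ∂μ = 0)
    {n : ℕ} (hn : 0 < n) (c : ℝ) :
    Integrable (fun ω : Fin n → Ω => (c + (n : ℝ)⁻¹ * ∑ i, X (ω i)) ^ 2)
        (Measure.pi fun _ => μ) ∧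
      ∫ ω : Fin n → Ω, (c + (n : ℝ)⁻¹ * ∑ i, X (ω i)) ^ 2 ∂(Measure.pi fun _ => μ) =
        c ^ 2 + (n : ℝ)⁻¹ * ∫ ω, X ω ^ 2 ∂μ := by
  have hn0 : (n : ℝ) ≠ 0 := Nat.cast_ne_zero.2 hn.ne'
  have hXi : ∀ i : Fin n, MemLp (fun ω : Fin n → Ω => X (ω i)) 2 (Measure.pi fun _ => μ) :=
    fun i => hX.comp_measurePreserving (measurePreserving_eval _ i)
  have hS : MemLp (fun ω : Fin n → Ω => ∑ i, X (ω i)) 2 (Measure.pi fun _ => μ) :=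
    memLp_finsetSum _ fun i _ => hXi i
  have hSi := hS.integrable one_le_two
  have hS0 : ∫ ω : Fin n → Ω, ∑ i, X (ω i) ∂(Measure.pi fun _ => μ) = 0 := by
    rw [integral_finsetSum _ fun i _ => (hXi i).integrable one_le_two]
    refine Finset.sum_eq_zero fun i _ => ?_
    rw [integral_comp_eval (μ := fun _ : Fin n => μ) (f := X) hX.aestronglyMeasurable, h0]
  have hvar : ∫ ω : Fin n → Ω, (∑ i, X (ω i)) ^ 2 ∂(Measure.pi fun _ => μ) =
      n * ∫ ω, X ω ^ 2 ∂μ := by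
    have h1 := variance_sum_pi (μ := fun _ : Fin n => μ) (X := fun _ => X) fun _ => hX
    have e : (∑ i : Fin n, fun ω : Fin n → Ω => X (ω i)) = fun ω => ∑ i, X (ω i) := by
      ext ω; simp
    rw [e, variance_of_integral_eq_zero hS.aestronglyMeasurable.aemeasurable hS0] at h1
    rw [h1, variance_of_integral_eq_zero hX.aestronglyMeasurable.aemeasurable h0]
    simp
  have e : ∀ ω : Fin n → Ω, (c + (n : ℝ)⁻¹ * ∑ i, X (ω i)) ^ 2 =
      c ^ 2 + 2 * c * (n : ℝ)⁻¹ * (∑ i, X (ω i)) + (n : ℝ)⁻¹ ^ 2 * (∑ i, X (ω i)) ^ 2 :=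
    fun ω => by ring
  have i1 : Integrable (fun ω : Fin n → Ω => c ^ 2 + 2 * c * (n : ℝ)⁻¹ * (∑ i, X (ω i)))
      (Measure.pi fun _ => μ) := (integrable_const _).add (hSi.const_mul _)
  have i2 : Integrable (fun ω : Fin n → Ω => (n : ℝ)⁻¹ ^ 2 * (∑ i, X (ω i)) ^ 2)
      (Measure.pi fun _ => μ) := hS.integrable_sq.const_mul _
  simp only [e]
  refine ⟨i1.add i2, ?_⟩
  rw [integral_add i1 i2, integral_add (integrable_const _) (hSi.const_mul _), integral_const_mul,
    integral_const_mul, hS0, hvar]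
  simp only [integral_const, probReal_univ, smul_eq_mul, one_mul]
  field_simp
  ring

/-- Second moment of a shifted average of independent centered random vectors. -/
theorem integral_norm_const_add_average_sq {d : ℕ} {X : Ω → Param d} (hX : MemLp X 2 μ)
    (h0 : ∫ ω, X ω ∂μ = 0) {n : ℕ} (hn : 0 < n) (c : Param d) :
    Integrable (fun ω : Fin n → Ω => ‖c + (n : ℝ)⁻¹ • ∑ i, X (ω i)‖ ^ 2)
        (Measure.pi fun _ => μ) ∧
      ∫ ω : Fin n → Ω, ‖c + (n : ℝ)⁻¹ • ∑ i, X (ω i)‖ ^ 2 ∂(Measure.pi fun _ => μ) =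
        ‖c‖ ^ 2 + (n : ℝ)⁻¹ * ∫ ω, ‖X ω‖ ^ 2 ∂μ := by
  have hXk : ∀ k, MemLp (fun ω => X ω k) 2 μ := fun k =>
    (EuclideanSpace.proj (𝕜 := ℝ) k).comp_memLp' hX
  have hk0 : ∀ k, ∫ ω, X ω k ∂μ = 0 := fun k => by
    have h := (EuclideanSpace.proj (𝕜 := ℝ) k).integral_comp_comm (hX.integrable one_le_two)
    rw [h0, map_zero] at h
    exact h
  have key := fun k => integral_const_add_average_sq (hXk k) (hk0 k) hn (c k)
  have e : ∀ ω : Fin n → Ω, ‖c + (n : ℝ)⁻¹ • ∑ i, X (ω i)‖ ^ 2 =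
      ∑ k, (c k + (n : ℝ)⁻¹ * ∑ i, X (ω i) k) ^ 2 := fun ω => by
    rw [EuclideanSpace.real_norm_sq_eq]
    simp
  simp only [e]
  refine ⟨integrable_finsetSum _ fun k _ => (key k).1, ?_⟩
  rw [integral_finsetSum _ fun k _ => (key k).1]
  simp only [fun k => (key k).2, EuclideanSpace.real_norm_sq_eq]
  rw [Finset.sum_add_distrib, integral_finsetSum _ fun k _ => (hXk k).integrable_sq,
    Finset.mul_sum]

theorem integral_norm_sub_integral_sq_le {d : ℕ} {X : Ω → Param d} (hX : MemLp X 2 μ) :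
    ∫ ω, ‖X ω - ∫ ω', X ω' ∂μ‖ ^ 2 ∂μ ≤ ∫ ω, ‖X ω‖ ^ 2 ∂μ := by
  set m := ∫ ω', X ω' ∂μ
  have hXi := hX.integrable one_le_two
  have hX2 : Integrable (fun ω => ‖X ω‖ ^ 2) μ := hX.integrable_norm_pow two_ne_zero
  have hin : Integrable (fun ω => 2 * inner ℝ m (X ω)) μ := (hXi.const_inner m).const_mul 2
  have e : ∀ ω, ‖X ω - m‖ ^ 2 = ‖X ω‖ ^ 2 - 2 * inner ℝ m (X ω) + ‖m‖ ^ 2 := fun ω => by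
    rw [norm_sub_sq_real, real_inner_comm]
  simp only [e]
  have hs : Integrable (fun ω => ‖X ω‖ ^ 2 - 2 * inner ℝ m (X ω)) μ := hX2.sub hin
  rw [integral_add hs (integrable_const _), integral_sub hX2 hin, integral_const_mul,
    integral_inner hXi, real_inner_self_eq_norm_sq]
  simp only [integral_const, probReal_univ, smul_eq_mul, one_mul]
  nlinarith [sq_nonneg ‖m‖]

end Average

/-! ### Mean squared errors of the two gradient estimates -/

namespace EpisodicMDP

variable {S A : Type*} [MeasurableSpace S] [MeasurableSpace A] {d : ℕ} {ν : Measure A}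
  [SigmaFinite ν] (𝓜 : EpisodicMDP S A) {Pol : PolicyClass S A d ν} {G M : ℝ}

theorem memLp_gpomdp (hP : Pol.IsSmooth G M) (θ : Param d) :
    MemLp (fun τ => 𝓜.gpomdp Pol θ τ) 2 (𝓜.trajLaw Pol θ) :=
  have := 𝓜.isProbabilityMeasure_trajLaw Pol θ
  MemLp.of_bound (𝓜.measurable_gpomdp_apply Pol θ).aestronglyMeasurable _
    (ae_of_all _ (𝓜.norm_gpomdp_le hP θ))

theorem memLp_gpomdpOff (hP : Pol.IsSmooth G M) (θ₂ θ₁ : Param d) :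
    MemLp (fun τ => 𝓜.gpomdpOff Pol θ₂ θ₁ τ) 2 (𝓜.trajLaw Pol θ₂) :=
  have := 𝓜.isProbabilityMeasure_trajLaw Pol θ₂
  MemLp.of_bound (𝓜.measurable_gpomdpOff_apply Pol θ₂ θ₁).aestronglyMeasurable _
    (ae_of_all _ (𝓜.norm_gpomdpOff_le hP θ₂ θ₁ le_rfl))

/-- Mean squared error of the large-batch estimate. -/
theorem integral_norm_largeEstimate_sub_sq (hP : Pol.IsSmooth G M) (θ : Param d) {n : ℕ}
    (hn : 0 < n) :
    Integrable (fun τ => ‖𝓜.largeEstimate Pol θ τ - gradient (𝓜.value Pol) θ‖ ^ 2)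
        (𝓜.batchLaw Pol n θ) ∧
      ∫ τ, ‖𝓜.largeEstimate Pol θ τ - gradient (𝓜.value Pol) θ‖ ^ 2 ∂(𝓜.batchLaw Pol n θ) =
        (n : ℝ)⁻¹ * ∫ τ, ‖𝓜.gpomdp Pol θ τ - gradient (𝓜.value Pol) θ‖ ^ 2
          ∂(𝓜.trajLaw Pol θ) := by
  have := 𝓜.isProbabilityMeasure_trajLaw Pol θ
  have hn0 : (n : ℝ) ≠ 0 := Nat.cast_ne_zero.2 hn.ne'
  have hX : MemLp (fun τ => 𝓜.gpomdp Pol θ τ - gradient (𝓜.value Pol) θ) 2 (𝓜.trajLaw Pol θ) :=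
    (𝓜.memLp_gpomdp hP θ).sub (memLp_const _)
  have h0 : ∫ τ, (𝓜.gpomdp Pol θ τ - gradient (𝓜.value Pol) θ) ∂(𝓜.trajLaw Pol θ) = 0 := by
    rw [integral_sub (𝓜.integrable_gpomdp hP θ) (integrable_const _), 𝓜.integral_gpomdp hP]
    simp
  have key := integral_norm_const_add_average_sq hX h0 hn 0
  have e : ∀ τ : Fin n → Traj S A 𝓜.H, 𝓜.largeEstimate Pol θ τ - gradient (𝓜.value Pol) θ =
      0 + (n : ℝ)⁻¹ • ∑ i, (𝓜.gpomdp Pol θ (τ i) - gradient (𝓜.value Pol) θ) := fun τ => by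
    rw [Finset.sum_sub_distrib, smul_sub, Finset.sum_const, Finset.card_univ, Fintype.card_fin,
      ← Nat.cast_smul_eq_nsmul ℝ, inv_smul_smul₀ hn0, zero_add]
    rfl
  simp only [e]
  refine ⟨key.1, key.2.trans ?_⟩
  simp

/-- Mean squared error of the recursive small-batch estimate. -/
theorem integral_norm_smallEstimate_sub_sq_le (hP : Pol.IsSmooth G M) (θ' θ v : Param d) {n : ℕ}
    (hn : 0 < n) :
    Integrable (fun τ => ‖𝓜.smallEstimate Pol θ' θ v τ - gradient (𝓜.value Pol) θ'‖ ^ 2)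
        (𝓜.batchLaw Pol n θ') ∧
      ∫ τ, ‖𝓜.smallEstimate Pol θ' θ v τ - gradient (𝓜.value Pol) θ'‖ ^ 2
          ∂(𝓜.batchLaw Pol n θ') ≤
        ‖v - gradient (𝓜.value Pol) θ‖ ^ 2 + (n : ℝ)⁻¹ *
          ∫ τ, ‖𝓜.gpomdp Pol θ' τ - 𝓜.gpomdpOff Pol θ' θ τ‖ ^ 2 ∂(𝓜.trajLaw Pol θ') := by
  have := 𝓜.isProbabilityMeasure_trajLaw Pol θ'
  have hn0 : (n : ℝ) ≠ 0 := Nat.cast_ne_zero.2 hn.ne'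
  have hY : MemLp (fun τ => 𝓜.gpomdp Pol θ' τ - 𝓜.gpomdpOff Pol θ' θ τ) 2 (𝓜.trajLaw Pol θ') :=
    (𝓜.memLp_gpomdp hP θ').sub (𝓜.memLp_gpomdpOff hP θ' θ)
  set m := gradient (𝓜.value Pol) θ' - gradient (𝓜.value Pol) θ with hm
  have hYm : ∫ τ, (𝓜.gpomdp Pol θ' τ - 𝓜.gpomdpOff Pol θ' θ τ) ∂(𝓜.trajLaw Pol θ') = m := by
    rw [integral_sub (𝓜.integrable_gpomdp hP θ') (𝓜.integrable_gpomdpOff hP θ' θ),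
      𝓜.integral_gpomdp hP, 𝓜.integral_gpomdpOff hP]
  have hX : MemLp (fun τ => 𝓜.gpomdp Pol θ' τ - 𝓜.gpomdpOff Pol θ' θ τ - m) 2
    (𝓜.trajLaw Pol θ') := hY.sub (memLp_const _)
  have h0 : ∫ τ, (𝓜.gpomdp Pol θ' τ - 𝓜.gpomdpOff Pol θ' θ τ - m) ∂(𝓜.trajLaw Pol θ') = 0 := by
    rw [integral_sub (hY.integrable one_le_two) (integrable_const _), hYm]
    simp
  -- The new error is the old error v - ∇V(θ) plus a centered average, because the off-policy
  -- estimator has mean ∇V(θ) under p(·|θ').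
  have key := integral_norm_const_add_average_sq hX h0 hn (v - gradient (𝓜.value Pol) θ)
  have e : ∀ τ : Fin n → Traj S A 𝓜.H,
      𝓜.smallEstimate Pol θ' θ v τ - gradient (𝓜.value Pol) θ' =
      (v - gradient (𝓜.value Pol) θ) + (n : ℝ)⁻¹ • ∑ i, (𝓜.gpomdp Pol θ' (τ i) -
        𝓜.gpomdpOff Pol θ' θ (τ i) - m) := fun τ => by
    rw [Finset.sum_sub_distrib, smul_sub, Finset.sum_const, Finset.card_univ, Fintype.card_fin,
      ← Nat.cast_smul_eq_nsmul ℝ, inv_smul_smul₀ hn0, Finset.sum_sub_distrib, smul_sub, hm]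
    unfold smallEstimate
    abel
  simp only [e]
  refine ⟨key.1, key.2.le.trans ?_⟩
  -- The variance of the estimator difference is bounded by its second moment.
  have h2 := integral_norm_sub_integral_sq_le hY
  rw [hYm] at h2
  gcongr

end EpisodicMDP

/-! ### The truncated Lyapunov function and its expected decrease -/

namespace EpisodicMDP

variable {S A : Type*} [MeasurableSpace S] [MeasurableSpace A] {d : ℕ} {ν : Measure A}
  (𝓜 : EpisodicMDP S A) {Pol : PolicyClass S A d ν} {G M : ℝ}

/-- The Lyapunov function of PAGE-PG: the optimality gap plus a multiple of the squared error of the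
gradient estimate. -/
noncomputable def lyapunov (Pol : PolicyClass S A d ν) (a : ℝ) (x : Param d × Param d) : ℝ :=
  𝓜.optValue Pol - 𝓜.value Pol x.1 + a * ‖x.2 - gradient (𝓜.value Pol) x.1‖ ^ 2

/-- The level at which the Lyapunov function is truncated. Below it the steps are so short that the
importance weights are under control, and above it the restarts alone give the required decrease. -/
noncomputable def truncLevel (G a : ℝ) : ℝ :=
  2 * 𝓜.R / (1 - 𝓜.γ) + a * (G * 𝓜.R / (1 - 𝓜.γ) ^ 2) ^ 2

/-- The Lyapunov function truncated at `truncLevel`. -/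
noncomputable def truncLyapunov (Pol : PolicyClass S A d ν) (G a : ℝ) (x : Param d × Param d) : ℝ :=
  min (𝓜.lyapunov Pol a x) (𝓜.truncLevel G a)

theorem truncLevel_nonneg {a : ℝ} (ha : 0 ≤ a) : 0 ≤ 𝓜.truncLevel G a := by
  have := 𝓜.R_pos
  have := sub_pos.2 𝓜.γ_lt_one
  unfold truncLevel
  positivity

theorem lintegral_pageStep (Pol : PolicyClass S A d ν) (N B : ℕ) (η p : ℝ) (x : Param d × Param d)
    {F : Param d × Param d → ENNReal} (hF : Measurable F) :
    ∫⁻ z, F z ∂(𝓜.pageStep Pol N B η p x) =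
      ENNReal.ofReal p * ∫⁻ τ, F (x.1 + η • x.2, 𝓜.largeEstimate Pol (x.1 + η • x.2) τ)
        ∂(𝓜.batchLaw Pol N (x.1 + η • x.2)) +
      ENNReal.ofReal (1 - p) * ∫⁻ τ, F (x.1 + η • x.2,
          𝓜.smallEstimate Pol (x.1 + η • x.2) x.1 x.2 τ)
        ∂(𝓜.batchLaw Pol B (x.1 + η • x.2)) := by
  have h₁ : Measurable fun τ : Fin N → Traj S A 𝓜.H =>
      (x.1 + η • x.2, 𝓜.largeEstimate Pol (x.1 + η • x.2) τ) :=
    𝓜.measurable_largeStep Pol η (measurable_const (a := x)) measurable_id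
  have h₂ : Measurable fun τ : Fin B → Traj S A 𝓜.H =>
      (x.1 + η • x.2, 𝓜.smallEstimate Pol (x.1 + η • x.2) x.1 x.2 τ) :=
    𝓜.measurable_smallStep Pol η (measurable_const (a := x)) measurable_id
  unfold pageStep
  rw [lintegral_add_measure, lintegral_smul_measure, lintegral_smul_measure,
    lintegral_map hF h₁, lintegral_map hF h₂]
  rfl

variable [SigmaFinite ν]

theorem bddAbove_range_value (Pol : PolicyClass S A d ν) : BddAbove (Set.range (𝓜.value Pol)) :=
  ⟨𝓜.R / (1 - 𝓜.γ), by
    rintro _ ⟨θ, rfl⟩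
    exact (abs_le.1 (𝓜.abs_value_le Pol θ)).2⟩

theorem value_le_optValue (Pol : PolicyClass S A d ν) (θ : Param d) :
    𝓜.value Pol θ ≤ 𝓜.optValue Pol :=
  le_ciSup (𝓜.bddAbove_range_value Pol) θ

theorem optValue_sub_value_le (Pol : PolicyClass S A d ν) (θ : Param d) :
    𝓜.optValue Pol - 𝓜.value Pol θ ≤ 2 * 𝓜.R / (1 - 𝓜.γ) := by
  have h1 : 𝓜.optValue Pol ≤ 𝓜.R / (1 - 𝓜.γ) :=
    ciSup_le fun θ => (abs_le.1 (𝓜.abs_value_le Pol θ)).2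
  have h2 := (abs_le.1 (𝓜.abs_value_le Pol θ)).1
  have e : 2 * 𝓜.R / (1 - 𝓜.γ) = 𝓜.R / (1 - 𝓜.γ) + 𝓜.R / (1 - 𝓜.γ) := by ring
  linarith

theorem measurable_truncLyapunov (hP : Pol.IsSmooth G M) (a : ℝ) :
    Measurable (𝓜.truncLyapunov Pol G a) := by
  have h1 := (𝓜.differentiable_value hP).continuous
  have h2 := 𝓜.continuous_gradient_value hP
  unfold truncLyapunov lyapunov
  exact Continuous.measurable (by fun_prop)

theorem lyapunov_nonneg (Pol : PolicyClass S A d ν) {a : ℝ} (ha : 0 ≤ a)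
    (x : Param d × Param d) : 0 ≤ 𝓜.lyapunov Pol a x :=
  add_nonneg (sub_nonneg.2 (𝓜.value_le_optValue Pol _)) (by positivity)

theorem truncLyapunov_nonneg (Pol : PolicyClass S A d ν) {a : ℝ} (ha : 0 ≤ a)
    (x : Param d × Param d) : 0 ≤ 𝓜.truncLyapunov Pol G a x :=
  le_min (𝓜.lyapunov_nonneg Pol ha x) (𝓜.truncLevel_nonneg ha)

/-- One gradient step decreases the optimality gap up to the error of the gradient estimate. -/
theorem optValue_sub_value_step_le (hP : Pol.IsSmooth G M) {η : ℝ} (hη : 0 < η)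
    (hηL : η * 𝓜.constL G M ≤ 1 / 2) (x : Param d × Param d) :
    𝓜.optValue Pol - 𝓜.value Pol (x.1 + η • x.2) ≤ 𝓜.optValue Pol - 𝓜.value Pol x.1 -
      η / 2 * ‖gradient (𝓜.value Pol) x.1‖ ^ 2 - η / 4 * ‖x.2‖ ^ 2 +
      η / 2 * ‖x.2 - gradient (𝓜.value Pol) x.1‖ ^ 2 := by
  have h := le_of_lipschitz_gradient (𝓜.differentiable_value hP)
    (𝓜.norm_gradient_value_sub_le hP) x.1 (η • x.2)
  rw [norm_smul, Real.norm_of_nonneg hη.le, real_inner_smul_right] at h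
  -- Expanding the squared error turns η⟨∇V, v⟩ into (η/2)(‖∇V‖² + ‖v‖² - ‖v - ∇V‖²). The curvature
  -- term uses up half of (η/2)‖v‖², as ηL ≤ 1/2.
  rw [norm_sub_sq_real]
  have h1 : 𝓜.constL G M / 2 * (η * ‖x.2‖) ^ 2 ≤ η / 4 * ‖x.2‖ ^ 2 := by
    have := mul_le_mul_of_nonneg_right hηL (by positivity : 0 ≤ η * ‖x.2‖ ^ 2 / 2)
    linarith
  rw [real_inner_comm] at h
  linarith

/-- Below the truncation level the steps are short. -/
theorem step_le_of_lyapunov_le (hP : Pol.IsSmooth G M) {η p : ℝ} (hη : 0 < η) (hp0 : 0 < p)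
    (hp1 : p ≤ 1) (hηL : η * 𝓜.constL G M ≤ 1 / 2) {x : Param d × Param d}
    (hx : 𝓜.lyapunov Pol (η / (2 * p)) x ≤ 𝓜.truncLevel G (η / (2 * p))) :
    (G * (η * ‖x.2‖)) ^ 2 ≤ 105 / 64 * (1 - 𝓜.γ) ^ 2 := by
  have hG := hP.G_pos
  have hM := hP.M_pos
  have hR := 𝓜.R_pos
  have hκ := sub_pos.2 𝓜.γ_lt_one
  unfold lyapunov truncLevel at hx
  have hV := 𝓜.value_le_optValue Pol x.1
  have hn := 𝓜.norm_gradient_value_le hP x.1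
  set κ := 1 - 𝓜.γ with hκd
  set g := G * 𝓜.R / κ ^ 2 with hg
  set e := ‖x.2 - gradient (𝓜.value Pol) x.1‖ with he
  set n := ‖gradient (𝓜.value Pol) x.1‖
  -- Only the second summand 2G²R/(1-γ)³ of L is needed here.
  have hQ : η * (G ^ 2 * 𝓜.R) ≤ κ ^ 3 / 4 := by
    have h1 : 2 * G ^ 2 * 𝓜.R / κ ^ 3 ≤ 𝓜.constL G M :=
      le_add_of_nonneg_left (by positivity)
    have h2 := (mul_le_mul_of_nonneg_left h1 hη.le).trans hηL
    rw [← mul_div_assoc, div_le_iff₀ (by positivity)] at h2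
    linarith
  have hv : ‖x.2‖ ≤ e + n := norm_le_norm_sub_add _ _
  -- Young's inequality in the form 2eg ≤ e²/4 + 4g².
  have hv2 : ‖x.2‖ ^ 2 ≤ 5 / 4 * e ^ 2 + 5 * g ^ 2 := by
    have h1 : ‖x.2‖ ^ 2 ≤ (e + g) ^ 2 :=
      pow_le_pow_left₀ (norm_nonneg _) (hv.trans (by linarith)) 2
    nlinarith [sq_nonneg (e / 2 - 2 * g)]
  have he2 : η * e ^ 2 ≤ 2 * p * (2 * 𝓜.R / κ) + η * g ^ 2 := by
    have h1 : η / (2 * p) * e ^ 2 ≤ 2 * 𝓜.R / κ + η / (2 * p) * g ^ 2 := by linarith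
    have h2 := mul_le_mul_of_nonneg_left h1 (by positivity : 0 ≤ 2 * p)
    have e1 : 2 * p * (η / (2 * p) * e ^ 2) = η * e ^ 2 := by field_simp
    have e2 : 2 * p * (2 * 𝓜.R / κ + η / (2 * p) * g ^ 2) = 2 * p * (2 * 𝓜.R / κ) + η * g ^ 2 := by
      field_simp
    linarith
  have h1 : (G * η * g) ^ 2 ≤ (κ / 4) ^ 2 := by
    refine pow_le_pow_left₀ (by positivity) ?_ 2
    have e1 : G * η * g = η * (G ^ 2 * 𝓜.R) / κ ^ 2 := by rw [hg]; ring
    rw [e1, div_le_iff₀ (by positivity)]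
    linarith
  have h2 : G ^ 2 * η * (2 * p * (2 * 𝓜.R / κ)) ≤ κ ^ 2 := by
    have e1 : G ^ 2 * η * (2 * p * (2 * 𝓜.R / κ)) = 4 * p * (η * (G ^ 2 * 𝓜.R)) / κ := by ring
    rw [e1, div_le_iff₀ hκ]
    have h3 : p * (η * (G ^ 2 * 𝓜.R)) ≤ 1 * (κ ^ 3 / 4) := by gcongr
    linarith
  have h3 := mul_le_mul_of_nonneg_left he2 (by positivity : 0 ≤ G ^ 2 * η)
  have h4 := mul_le_mul_of_nonneg_left hv2 (by positivity : 0 ≤ (G * η) ^ 2)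
  -- After multiplication by (Gη)², e² contributes at most (1 + 1/16)κ² and g² at most κ²/16, and
  -- (5/4)(17/16) + 5/16 = 105/64.
  nlinarith

/-- If `y` has mean squared error at most `D` as an estimate of the gradient, then the expected
Lyapunov function is bounded accordingly. -/
theorem lintegral_truncLyapunov_le {Ω : Type*} [MeasurableSpace Ω] {μ : Measure Ω}
    [IsProbabilityMeasure μ] (Pol : PolicyClass S A d ν) {a : ℝ} (ha : 0 ≤ a) (θ : Param d)
    {y : Ω → Param d} {D : ℝ}
    (hi : Integrable (fun ω => ‖y ω - gradient (𝓜.value Pol) θ‖ ^ 2) μ)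
    (hD : ∫ ω, ‖y ω - gradient (𝓜.value Pol) θ‖ ^ 2 ∂μ ≤ D) :
    ∫⁻ ω, ENNReal.ofReal (𝓜.truncLyapunov Pol G a (θ, y ω)) ∂μ ≤
      ENNReal.ofReal (𝓜.optValue Pol - 𝓜.value Pol θ + a * D) := by
  have hli : Integrable (fun ω => 𝓜.lyapunov Pol a (θ, y ω)) μ :=
    (integrable_const (𝓜.optValue Pol - 𝓜.value Pol θ)).add (hi.const_mul a)
  calc _ ≤ ∫⁻ ω, ENNReal.ofReal (𝓜.lyapunov Pol a (θ, y ω)) ∂μ :=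
        lintegral_mono fun ω => ENNReal.ofReal_le_ofReal (min_le_left _ _)
    _ = ENNReal.ofReal (∫ ω, 𝓜.lyapunov Pol a (θ, y ω) ∂μ) :=
        (ofReal_integral_eq_lintegral_ofReal hli
          (ae_of_all _ fun ω => 𝓜.lyapunov_nonneg Pol ha _)).symm
    _ ≤ _ := by
        refine ENNReal.ofReal_le_ofReal ?_
        simp only [lyapunov]
        rw [integral_add (integrable_const _) (hi.const_mul a), integral_const_mul]
        simp only [integral_const, probReal_univ, smul_eq_mul, one_mul]
        gcongr

/-- The variance added by a short small-batch step is compensated by the length of the step. -/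
theorem mul_integral_norm_gpomdp_sub_sq_le (hP : Pol.IsSmooth G M) {W : ℝ} (hW : 0 < W) {B : ℕ}
    (hB : 0 < B) {η p : ℝ} (hη : 0 < η) (hp0 : 0 < p) (hp1 : p ≤ 1)
    (hηC : p < 1 → η ^ 2 ≤ p / (1 - p) * (B / (2 * 𝓜.constC G M W))) {θ v : Param d}
    (hnear : (G * (η * ‖v‖)) ^ 2 ≤ 105 / 64 * (1 - 𝓜.γ) ^ 2) :
    (1 - p) * (η / (2 * p) * ((B : ℝ)⁻¹ * ∫ τ, ‖𝓜.gpomdp Pol (θ + η • v) τ -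
      𝓜.gpomdpOff Pol (θ + η • v) θ τ‖ ^ 2 ∂(𝓜.trajLaw Pol (θ + η • v)))) ≤
      η / 4 * ‖v‖ ^ 2 := by
  have hG := hP.G_pos
  have hM := hP.M_pos
  have hR := 𝓜.R_pos
  have hγ := 𝓜.γ_pos
  have hκ := sub_pos.2 𝓜.γ_lt_one
  have hB0 : (0 : ℝ) < B := Nat.cast_pos.2 hB
  -- For p = 1 the recursive branch has probability zero, and no condition involving C is available
  -- or needed.
  rcases hp1.eq_or_lt with h1 | h1
  · rw [h1, sub_self, zero_mul]
    positivity
  have hd : ‖θ - (θ + η • v)‖ = η * ‖v‖ := by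
    rw [sub_add_cancel_left, norm_neg, norm_smul, Real.norm_of_nonneg hη.le]
  have hD := 𝓜.integral_norm_gpomdp_sub_sq_le_two_mul hP (θ₂ := θ + η • v) (θ₁ := θ)
    (by rwa [hd])
  rw [hd] at hD
  generalize ∫ τ, ‖𝓜.gpomdp Pol (θ + η • v) τ - 𝓜.gpomdpOff Pol (θ + η • v) θ τ‖ ^ 2
    ∂(𝓜.trajLaw Pol (θ + η • v)) = D at hD ⊢
  have hq := sub_pos.2 h1
  have hL := 𝓜.constL_pos hG hM
  have hω : 0 ≤ 𝓜.constCω G M W := by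
    unfold constCω
    positivity
  have hCe : 𝓜.constC G M W = 2 * (𝓜.constL G M ^ 2 + 𝓜.constCω G M W) := rfl
  have hC0 : 0 < 𝓜.constC G M W := by
    rw [hCe]
    positivity
  -- The bound 2L² on the second moment is at most C, since C_ω ≥ 0.
  have hDC : D ≤ 𝓜.constC G M W * (η ^ 2 * ‖v‖ ^ 2) := by
    refine hD.trans ?_
    rw [mul_pow]
    refine mul_le_mul_of_nonneg_right ?_ (by positivity)
    linarith
  have hC := hηC h1
  rw [div_mul_div_comm, le_div_iff₀ (by positivity)] at hC
  have h2 : (1 - p) * D ≤ B * p / 2 * ‖v‖ ^ 2 := by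
    have h3 := mul_le_mul_of_nonneg_left hDC hq.le
    have h4 := mul_le_mul_of_nonneg_right hC (sq_nonneg ‖v‖)
    linarith
  have h3 := mul_le_mul_of_nonneg_left h2 (by positivity : 0 ≤ η / (2 * p) * (B : ℝ)⁻¹)
  have e3 : η / (2 * p) * (B : ℝ)⁻¹ * (B * p / 2 * ‖v‖ ^ 2) = η / 4 * ‖v‖ ^ 2 := by
    field_simp
    ring
  rw [e3] at h3
  linarith

/-- A bound `b` on the expected truncated Lyapunov function after a small-batch step, together with
the resulting decrease. -/
theorem exists_smallStep_bound (hP : Pol.IsSmooth G M) {W : ℝ} (hW : 0 < W) {B : ℕ} (hB : 0 < B)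
    {η p : ℝ} (hη : 0 < η) (hp0 : 0 < p) (hp1 : p ≤ 1)
    (hηC : p < 1 → η ^ 2 ≤ p / (1 - p) * (B / (2 * 𝓜.constC G M W)))
    (hηL : η * 𝓜.constL G M ≤ 1 / 2) (s : ℝ) (x : Param d × Param d) :
    ∃ b : ℝ, 0 ≤ b ∧
      ∫⁻ τ, ENNReal.ofReal (𝓜.truncLyapunov Pol G (η / (2 * p)) (x.1 + η • x.2,
        𝓜.smallEstimate Pol (x.1 + η • x.2) x.1 x.2 τ)) ∂(𝓜.batchLaw Pol B (x.1 + η • x.2)) ≤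
        ENNReal.ofReal b ∧
      p * (𝓜.optValue Pol - 𝓜.value Pol (x.1 + η • x.2) + η / (2 * p) * s) + (1 - p) * b +
          η / 2 * ‖gradient (𝓜.value Pol) x.1‖ ^ 2 ≤
        𝓜.truncLyapunov Pol G (η / (2 * p)) x + η / 2 * s := by
  have hPB := 𝓜.isProbabilityMeasure_batchLaw Pol B (x.1 + η • x.2)
  have hgap := 𝓜.optValue_sub_value_step_le hP hη hηL x
  have ha : 0 < η / (2 * p) := by positivity
  have hap : p * (η / (2 * p)) = η / 2 := by field_simp
  -- Below the level, the step is short and b is the untruncated bound for the recursive estimate;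
  -- above it, b is the truncation level.
  rcases le_or_gt (𝓜.lyapunov Pol (η / (2 * p)) x) (𝓜.truncLevel G (η / (2 * p))) with hx | hx
  · have hkey := 𝓜.mul_integral_norm_gpomdp_sub_sq_le hP hW hB hη hp0 hp1 hηC (θ := x.1)
      (𝓜.step_le_of_lyapunov_le hP hη hp0 hp1 hηL hx)
    obtain ⟨hsi, hsl⟩ := 𝓜.integral_norm_smallEstimate_sub_sq_le hP (x.1 + η • x.2) x.1 x.2 hB
    have I := 𝓜.lintegral_truncLyapunov_le (G := G) Pol ha.le (x.1 + η • x.2) hsi hsl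
    refine ⟨_, ?_, I, ?_⟩
    · exact add_nonneg (sub_nonneg.2 (𝓜.value_le_optValue Pol _))
        (mul_nonneg ha.le (add_nonneg (sq_nonneg _) (mul_nonneg (by positivity)
          (integral_nonneg fun τ => sq_nonneg _))))
    · have hΨ : 𝓜.truncLyapunov Pol G (η / (2 * p)) x = 𝓜.optValue Pol - 𝓜.value Pol x.1 +
          η / (2 * p) * ‖x.2 - gradient (𝓜.value Pol) x.1‖ ^ 2 := min_eq_left hx
      rw [hΨ]
      clear hΨ I hsi hsl hx hPB hηC hηL
      generalize ∫ τ, ‖𝓜.gpomdp Pol (x.1 + η • x.2) τ - 𝓜.gpomdpOff Pol (x.1 + η • x.2) x.1 τ‖ ^ 2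
        ∂(𝓜.trajLaw Pol (x.1 + η • x.2)) = D at hkey ⊢
      generalize η / (2 * p) = a at *
      generalize ‖x.2 - gradient (𝓜.value Pol) x.1‖ ^ 2 = e at *
      have e1 : p * (a * s) = η / 2 * s := by rw [← mul_assoc, hap]
      have e2 : p * (a * e) = η / 2 * e := by rw [← mul_assoc, hap]
      linarith
  · refine ⟨𝓜.truncLevel G (η / (2 * p)), 𝓜.truncLevel_nonneg ha.le, ?_, ?_⟩
    · refine (lintegral_mono fun τ => ENNReal.ofReal_le_ofReal (min_le_right _ _)).trans ?_
      simp
    · have hΨ : 𝓜.truncLyapunov Pol G (η / (2 * p)) x = 𝓜.truncLevel G (η / (2 * p)) :=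
        min_eq_right hx.le
      rw [hΨ]
      have h3 := mul_le_mul_of_nonneg_left (𝓜.optValue_sub_value_le Pol (x.1 + η • x.2)) hp0.le
      have h4 := mul_le_mul_of_nonneg_left
        (pow_le_pow_left₀ (norm_nonneg _) (𝓜.norm_gradient_value_le hP x.1) 2)
        (by positivity : 0 ≤ η / 2)
      -- The level is built for this identity: p times it is the worst gap after a restart, weighted
      -- by p, plus η/2 times the squared bound on ‖∇V‖.
      have e1 : p * 𝓜.truncLevel G (η / (2 * p)) = p * (2 * 𝓜.R / (1 - 𝓜.γ)) +
          p * (η / (2 * p)) * (G * 𝓜.R / (1 - 𝓜.γ) ^ 2) ^ 2 := by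
        unfold truncLevel; ring
      have e2 : p * (η / (2 * p) * s) = η / 2 * s := by rw [← mul_assoc, hap]
      rw [hap] at e1
      linarith

/-- Expected decrease of the truncated Lyapunov function in one iteration of PAGE-PG. -/
theorem lintegral_truncLyapunov_pageStep_le (hP : Pol.IsSmooth G M) {W : ℝ} (hW : 0 < W)
    {σ : ℝ}
    (hvar : ∀ θ, ∫ τ, ‖𝓜.gpomdp Pol θ τ - gradient (𝓜.value Pol) θ‖ ^ 2
      ∂(𝓜.trajLaw Pol θ) ≤ σ ^ 2)
    {N B : ℕ} (hN : 0 < N) (hB : 0 < B) {η p : ℝ} (hη : 0 < η) (hp0 : 0 < p) (hp1 : p ≤ 1)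
    (hηC : p < 1 → η ^ 2 ≤ p / (1 - p) * (B / (2 * 𝓜.constC G M W)))
    (hηL : η * 𝓜.constL G M ≤ 1 / 2) (x : Param d × Param d) :
    ∫⁻ z, ENNReal.ofReal (𝓜.truncLyapunov Pol G (η / (2 * p)) z) ∂(𝓜.pageStep Pol N B η p x) +
        ENNReal.ofReal (η / 2 * ‖gradient (𝓜.value Pol) x.1‖ ^ 2) ≤
      ENNReal.ofReal (𝓜.truncLyapunov Pol G (η / (2 * p)) x) +
        ENNReal.ofReal (η / 2 * (σ ^ 2 / N)) := by
  have hPN := 𝓜.isProbabilityMeasure_batchLaw Pol N (x.1 + η • x.2)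
  have ha : 0 < η / (2 * p) := by positivity
  have hq : 0 ≤ 1 - p := sub_nonneg.2 hp1
  obtain ⟨hli, hle⟩ := 𝓜.integral_norm_largeEstimate_sub_sq hP (x.1 + η • x.2) hN
  have hlarge : ∫ τ, ‖𝓜.largeEstimate Pol (x.1 + η • x.2) τ -
      gradient (𝓜.value Pol) (x.1 + η • x.2)‖ ^ 2 ∂(𝓜.batchLaw Pol N (x.1 + η • x.2)) ≤
      σ ^ 2 / N := by
    rw [hle, div_eq_inv_mul]
    exact mul_le_mul_of_nonneg_left (hvar _) (by positivity)
  have I1 := 𝓜.lintegral_truncLyapunov_le (G := G) Pol ha.le (x.1 + η • x.2) hli hlarge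
  obtain ⟨b, hb, I2, hmain⟩ := 𝓜.exists_smallStep_bound hP hW hB hη hp0 hp1 hηC hηL (σ ^ 2 / N) x
  have hgap : 0 ≤ 𝓜.optValue Pol - 𝓜.value Pol (x.1 + η • x.2) + η / (2 * p) * (σ ^ 2 / N) :=
    add_nonneg (sub_nonneg.2 (𝓜.value_le_optValue Pol _)) (by positivity)
  rw [𝓜.lintegral_pageStep Pol N B η p x
    (𝓜.measurable_truncLyapunov hP (η / (2 * p))).ennreal_ofReal,
    ← ENNReal.ofReal_add (𝓜.truncLyapunov_nonneg Pol ha.le x) (by positivity)]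
  refine (add_le_add_left (add_le_add (mul_le_mul_right I1 _) (mul_le_mul_right I2 _)) _).trans ?_
  rw [← ENNReal.ofReal_mul hp0.le, ← ENNReal.ofReal_mul hq,
    ← ENNReal.ofReal_add (mul_nonneg hp0.le hgap) (mul_nonneg hq hb),
    ← ENNReal.ofReal_add (add_nonneg (mul_nonneg hp0.le hgap) (mul_nonneg hq hb))
      (by positivity)]
  exact ENNReal.ofReal_le_ofReal hmain

theorem lintegral_truncLyapunov_pageLaw_zero_le (hP : Pol.IsSmooth G M) {σ : ℝ}
    (hvar : ∀ θ, ∫ τ, ‖𝓜.gpomdp Pol θ τ - gradient (𝓜.value Pol) θ‖ ^ 2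
      ∂(𝓜.trajLaw Pol θ) ≤ σ ^ 2)
    (θ₀ : Param d) {N : ℕ} (B : ℕ) (hN : 0 < N) (η p : ℝ) {a : ℝ} (ha : 0 ≤ a) :
    ∫⁻ x, ENNReal.ofReal (𝓜.truncLyapunov Pol G a x) ∂(𝓜.pageLaw Pol θ₀ N B η p 0) ≤
      ENNReal.ofReal (𝓜.optValue Pol - 𝓜.value Pol θ₀ + a * (σ ^ 2 / N)) := by
  have hPN := 𝓜.isProbabilityMeasure_batchLaw Pol N θ₀
  have hm : Measurable fun τ : Fin N → Traj S A 𝓜.H => (θ₀, 𝓜.largeEstimate Pol θ₀ τ) :=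
    measurable_const.prodMk (𝓜.measurable_largeEstimate Pol measurable_const measurable_id)
  unfold pageLaw
  rw [lintegral_map (𝓜.measurable_truncLyapunov hP a).ennreal_ofReal hm]
  refine 𝓜.lintegral_truncLyapunov_le Pol ha θ₀
    (𝓜.integral_norm_largeEstimate_sub_sq hP θ₀ hN).1 ?_
  rw [(𝓜.integral_norm_largeEstimate_sub_sq hP θ₀ hN).2, div_eq_inv_mul]
  exact mul_le_mul_of_nonneg_left (hvar θ₀) (by positivity)

theorem integrable_norm_gradient_sq_pageLaw (hP : Pol.IsSmooth G M) (θ₀ : Param d) (N B : ℕ)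
    (η : ℝ) {p : ℝ} (hp0 : 0 ≤ p) (hp1 : p ≤ 1) (t : ℕ) :
    Integrable (fun x => ‖gradient (𝓜.value Pol) x.1‖ ^ 2) (𝓜.pageLaw Pol θ₀ N B η p t) := by
  have := 𝓜.isProbabilityMeasure_pageLaw Pol θ₀ N B η p hp0 hp1 t
  have hm : Measurable fun x : Param d × Param d => ‖gradient (𝓜.value Pol) x.1‖ ^ 2 :=
    ((𝓜.continuous_gradient_value hP).measurable.comp measurable_fst).norm.pow_const 2
  refine Integrable.of_bound hm.aestronglyMeasurable ((G * 𝓜.R / (1 - 𝓜.γ) ^ 2) ^ 2)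
    (ae_of_all _ fun x => ?_)
  rw [norm_pow, norm_norm]
  exact pow_le_pow_left₀ (norm_nonneg _) (𝓜.norm_gradient_value_le hP x.1) 2

end EpisodicMDP

/-! ### Summation over the iterations -/

theorem theorem1 {S A : Type*} [MeasurableSpace S] [MeasurableSpace A] {d : ℕ} {ν : Measure A}
    [SigmaFinite ν] (𝓜 : EpisodicMDP S A) (Pol : PolicyClass S A d ν)
    -- bounded score
    (G : ℝ) (hG : 0 < G) (hscore : ∀ θ s a, ‖Pol.score θ s a‖ ≤ G)
    -- twice differentiable policies with bounded log-policy Hessian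
    (M : ℝ) (hM : 0 < M)
    (hdiff : ∀ s a, Differentiable ℝ (gradient fun θ => Pol.π θ s a))
    (hhess : ∀ θ s a, ‖fderiv ℝ (fun θ' => Pol.score θ' s a) θ‖ ≤ M)
    -- finite variance of the gradient estimator
    (σ : ℝ) (hσ : 0 < σ)
    (hvar : ∀ θ, ∫ τ, ‖𝓜.gpomdp Pol θ τ - ∫ τ', 𝓜.gpomdp Pol θ τ' ∂(𝓜.trajLaw Pol θ)‖ ^ 2
      ∂(𝓜.trajLaw Pol θ) ≤ σ ^ 2)
    -- finite importance weight variance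
    (W : ℝ) (hW : 0 < W)
    (hweight : ∀ θa θb, evariance (Pol.weight θb θa) (𝓜.trajLaw Pol θb) ≤ ENNReal.ofReal W)
    -- parameters of the algorithm
    (θ₀ : Param d) (N B T : ℕ) (hN : 0 < N) (hB : 0 < B) (hT : 0 < T)
    (η p : ℝ) (hη : 0 < η) (hp0 : 0 < p) (hp1 : p ≤ 1)
    (hηC : p < 1 → η ^ 2 ≤ p / (1 - p) * (B / (2 * 𝓜.constC G M W)))
    (hηL : η ^ 2 ≤ 1 / (4 * 𝓜.constL G M ^ 2)) :
    Differentiable ℝ (𝓜.value Pol) ∧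
    BddAbove (Set.range (𝓜.value Pol)) ∧
    (∀ t, Integrable (fun x => ‖gradient (𝓜.value Pol) x.1‖ ^ 2) (𝓜.pageLaw Pol θ₀ N B η p t)) ∧
    (1 / (T : ℝ)) * ∑ t ∈ Finset.range T,
        ∫ x, ‖gradient (𝓜.value Pol) x.1‖ ^ 2 ∂(𝓜.pageLaw Pol θ₀ N B η p t)
      ≤ 2 * (𝓜.optValue Pol - 𝓜.value Pol θ₀) / (η * T) + σ ^ 2 / N + σ ^ 2 / (p * N * T) := by
  have hP : Pol.IsSmooth G M :=
    ⟨hG, hM, hscore, Pol.differentiable_score_of_gradient hdiff, hhess⟩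
  have hvar' : ∀ θ, ∫ τ, ‖𝓜.gpomdp Pol θ τ - gradient (𝓜.value Pol) θ‖ ^ 2
      ∂(𝓜.trajLaw Pol θ) ≤ σ ^ 2 := fun θ => by
    simpa only [𝓜.integral_gpomdp hP θ] using hvar θ
  have hηL' : η * 𝓜.constL G M ≤ 1 / 2 := by
    have hL := 𝓜.constL_pos hG hM
    rw [le_div_iff₀ (by positivity)] at hηL
    refine (abs_le_of_sq_le_sq' ?_ (by norm_num)).2
    linarith
  have hint := fun t => 𝓜.integrable_norm_gradient_sq_pageLaw hP θ₀ N B η hp0.le hp1 t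
  refine ⟨𝓜.differentiable_value hP, 𝓜.bddAbove_range_value Pol, hint, ?_⟩
  have hN0 : (0 : ℝ) < N := Nat.cast_pos.2 hN
  have hT0 : (0 : ℝ) < T := Nat.cast_pos.2 hT
  set a := η / (2 * p) with had
  have ha : 0 < a := by positivity
  have hmeas := (𝓜.measurable_truncLyapunov hP a).ennreal_ofReal
  set ℓ : ℕ → ENNReal := fun t =>
    ∫⁻ x, ENNReal.ofReal (𝓜.truncLyapunov Pol G a x) ∂(𝓜.pageLaw Pol θ₀ N B η p t)
  set I : ℕ → ℝ := fun t =>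
    ∫ x, ‖gradient (𝓜.value Pol) x.1‖ ^ 2 ∂(𝓜.pageLaw Pol θ₀ N B η p t)
  have hI : ∀ t, 0 ≤ I t := fun t => integral_nonneg fun x => by positivity
  -- Integrating the one-step decrease over the law at time t. Staying in `ENNReal` lets the
  -- Lyapunov terms be handled without integrability proofs, at the price of keeping all terms on
  -- their additive side.
  have hstep : ∀ t, ℓ (t + 1) + ENNReal.ofReal (η / 2 * I t) ≤
      ℓ t + ENNReal.ofReal (η / 2 * (σ ^ 2 / N)) := by
    intro t
    have hpt := 𝓜.isProbabilityMeasure_pageLaw Pol θ₀ N B η p hp0.le hp1 t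
    have e1 : ℓ (t + 1) = ∫⁻ x, ∫⁻ z, ENNReal.ofReal (𝓜.truncLyapunov Pol G a z)
        ∂(𝓜.pageStep Pol N B η p x) ∂(𝓜.pageLaw Pol θ₀ N B η p t) :=
      Measure.lintegral_bind (𝓜.measurable_pageStep Pol N B η p).aemeasurable hmeas.aemeasurable
    have e2 : ENNReal.ofReal (η / 2 * I t) =
        ∫⁻ x, ENNReal.ofReal (η / 2 * ‖gradient (𝓜.value Pol) x.1‖ ^ 2)
          ∂(𝓜.pageLaw Pol θ₀ N B η p t) := by
      rw [← ofReal_integral_eq_lintegral_ofReal ((hint t).const_mul _)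
        (ae_of_all _ fun x => by positivity), integral_const_mul]
    have hm2 : Measurable fun x : Param d × Param d =>
        ENNReal.ofReal (η / 2 * ‖gradient (𝓜.value Pol) x.1‖ ^ 2) :=
      ((((𝓜.continuous_gradient_value hP).measurable.comp
        measurable_fst).norm.pow_const 2).const_mul _).ennreal_ofReal
    rw [e1, e2, ← lintegral_add_right _ hm2]
    refine (lintegral_mono fun x => 𝓜.lintegral_truncLyapunov_pageStep_le hP hW hvar' hN hB hη hp0
      hp1 hηC hηL' x).trans (le_of_eq ?_)
    rw [lintegral_add_right _ measurable_const]
    simp [ℓ, had]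
  have hsum : ∀ n : ℕ, ℓ n + ENNReal.ofReal (η / 2 * ∑ t ∈ Finset.range n, I t) ≤
      ℓ 0 + ENNReal.ofReal (n * (η / 2 * (σ ^ 2 / N))) := by
    intro n
    induction n with
    | zero => simp
    | succ n ih =>
      have e1 : ENNReal.ofReal (η / 2 * ∑ t ∈ Finset.range (n + 1), I t) =
          ENNReal.ofReal (η / 2 * I n) + ENNReal.ofReal (η / 2 * ∑ t ∈ Finset.range n, I t) := by
        have := hI n
        have : 0 ≤ ∑ t ∈ Finset.range n, I t := Finset.sum_nonneg fun t _ => hI t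
        rw [← ENNReal.ofReal_add (by positivity) (by positivity), Finset.sum_range_succ]
        congr 1
        ring
      have e2 : ENNReal.ofReal (((n + 1 : ℕ) : ℝ) * (η / 2 * (σ ^ 2 / N))) =
          ENNReal.ofReal (n * (η / 2 * (σ ^ 2 / N))) + ENNReal.ofReal (η / 2 * (σ ^ 2 / N)) := by
        rw [← ENNReal.ofReal_add (by positivity) (by positivity)]
        congr 1
        push_cast
        ring
      rw [e1, e2, ← add_assoc, ← add_assoc]
      refine (add_le_add_left (hstep n) _).trans ?_
      rw [add_right_comm]
      exact add_le_add_left ih _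
  have h0 := 𝓜.lintegral_truncLyapunov_pageLaw_zero_le hP hvar' θ₀ B hN η p ha.le
  have hgap : 0 ≤ 𝓜.optValue Pol - 𝓜.value Pol θ₀ :=
    sub_nonneg.2 (𝓜.value_le_optValue Pol θ₀)
  have hfin : η / 2 * ∑ t ∈ Finset.range T, I t ≤
      𝓜.optValue Pol - 𝓜.value Pol θ₀ + a * (σ ^ 2 / N) + T * (η / 2 * (σ ^ 2 / N)) := by
    refine (ENNReal.ofReal_le_ofReal_iff (by positivity)).1 ?_
    rw [ENNReal.ofReal_add (by positivity) (by positivity)]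
    -- The final Lyapunov term is nonnegative and is dropped.
    exact le_add_self.trans ((hsum T).trans (add_le_add_left h0 _))
  have h2 := mul_le_mul_of_nonneg_left hfin (by positivity : 0 ≤ 2 / (η * T))
  have e1 : 2 / (η * T) * (η / 2 * ∑ t ∈ Finset.range T, I t) =
      1 / (T : ℝ) * ∑ t ∈ Finset.range T, I t := by field_simp
  -- The error of v₀ enters through a = η/(2p) and gives σ²/(pNT); the T restart errors give σ²/N.
  have e2 : 2 / (η * T) * (𝓜.optValue Pol - 𝓜.value Pol θ₀ + a * (σ ^ 2 / N) +
      T * (η / 2 * (σ ^ 2 / N))) = 2 * (𝓜.optValue Pol - 𝓜.value Pol θ₀) / (η * T) +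
      σ ^ 2 / N + σ ^ 2 / (p * N * T) := by
    rw [had]
    field_simp
    ring
  rw [e1, e2] at h2
  exact h2
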